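/- \textbf{Setting.} Let $n\ge 1$, let $u_1,\dots,u_m\in\mathbb{R}^n$ with $m\ge n$ be the columns of a matrix $A\in\mathbb{R}^{n\times m}$ of rank $n$, and let $T\subseteq\mathbb{R}^n$ be a linear subspace of dimension $d$. The set of inliers is $L=\{i\in[m] : u_i\in T\}$. Assume (1) for every $V\subseteq[m]$ with $|V|=n$, the columns $(u_i)_{i\in V}$ are linearly independent if and only if $|V\cap L|\le d$; (2) $T$ contains more than a $\frac dn$ fraction of the points: $|L|>\frac dn\,m$. For $V\subseteq[m]$ let $A_V$ be the submatrix of the columns in $V$, and let $K_{A_V}\subset\mathbb{R}^V$ be its basis polytope, i.e. the set of $x$ in $\mathrm{conv}\{\mathbf 1_U : U\subseteq V,\ \dim\mathrm{span}\{u_i : i\in U\}=|U|\}$ with $\sum_{i\in V} x_i=n$. \textbf{DerandomizedFind} (input: $A$). Set $U=[m]$. While $|U|>n$: go through the elements $i\in U$ in order, checking whether $\frac{n}{|U\setminus\{i\}|}\vec 1\in K_{A_{U\setminus\{i\}}}$, and at the first $i$ for which the answer is NO, replace $U$ by $U\setminus\{i\}$. After the loop, find a nonzero vector $w$ in the kernel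 of $A_U$, set $T'=\mathrm{span}\{u_i : w_i\ne 0\}$ and return $L'=\{i\in[m] : u_i\in T'\}$. \textbf{Theorem.} Under these assumptions DerandomizedFind terminates and computes $T$ and $L$: for every fixed scan order, the while loop never gets stuck and the kernel of the final $A_U$ contains a nonzero vector, and for every choice of such a vector $w$ one has $T'=T$ and $L'=L$. Moreover the running time is bounded by a fixed polynomial in $n$ and $m$: there are a single deterministic real-RAM program (exact real arithmetic and comparisons at unit cost, natural-number index arithmetic by addition and subtraction, integer program constants only) and a single polynomial $p$ such that on every input $(n,m,A)$ that satisfies the assumptions for some $T$ and $d$ (which are not part of the input), the program halts after at most $p(n,m)$ steps and outputs a run of DerandomizedFind with index scan order, namely the list of deleted indices in order, the kernel vector $w$, and the returned set $L'=L$. -/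

import Mathlib

namespace RobustSubspace

noncomputable section

/-! ### Robust subspace recovery: inliers and the general position condition -/

open Classical in
/-- The inliers: the indices of the columns of `A` that lie in the subspace `T`. -/
def inliers {n m : ℕ} (A : Matrix (Fin n) (Fin m) ℝ) (T : Submodule ℝ (Fin n → ℝ)) :
    Finset (Fin m) :=
  Finset.univ.filter fun i => A.col i ∈ T

/-- A set of `n` columns of `A` is linearly independent if and only if at most `d` of these
columns are inliers. -/
def GeneralPosition {n m : ℕ} (A : Matrix (Fin n) (Fin m) ℝ) (T : Submodule ℝ (Fin n → ℝ))
    (d : ℕ) : Prop :=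
  ∀ V : Finset (Fin m), V.card = n →
    (LinearIndependent ℝ (fun i : V => A.col i) ↔ (V ∩ inliers A T).card ≤ d)

/-! ### The independent set polytope and the basis polytope -/

/-- The independent set polytope `conv {1_U : dim span {u_i : i ∈ U} = |U|}` of the columns. -/
def indepPolytope {n : ℕ} {ι : Type*} (A : Matrix (Fin n) ι ℝ) : Set (ι → ℝ) :=
  convexHull ℝ {x | ∃ U : Finset ι,
    Module.finrank ℝ (Submodule.span ℝ (A.col '' (U : Set ι))) = U.card ∧
    x = Set.indicator (U : Set ι) 1}

/-- The basis polytope `K_A`: the face of the independent set polytope on which the coordinates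
sum to `n`. -/
def basisPolytope {n : ℕ} {ι : Type*} [Fintype ι] (A : Matrix (Fin n) ι ℝ) : Set (ι → ℝ) :=
  {x ∈ indepPolytope A | ∑ i, x i = (n : ℝ)}

/-- The submatrix `A_V` of the columns in `V`. -/
def colsOn {n m : ℕ} (A : Matrix (Fin n) (Fin m) ℝ) (V : Finset (Fin m)) :
    Matrix (Fin n) V ℝ :=
  A.submatrix id Subtype.val

/-- The membership check for `V` answers NO: the vector `(n / |V|) 1` is outside `K_{A_V}`. -/
def AnswersNo {n m : ℕ} (A : Matrix (Fin n) (Fin m) ℝ) (V : Finset (Fin m)) : Prop :=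
  (fun _ : V => (n : ℝ) / (V.card : ℝ)) ∉ basisPolytope (colsOn A V)

/-! ### The algorithm DerandomizedFind -/

/-- `LoopRun A π U D W`: the while loop, entered with the current set `U`, terminates with the
set `W` after deleting the indices in the list `D` in this order. As long as `|U| > n`, each
iteration scans `U` in the order given by `π` (`j` comes before `i` if `π j < π i`) and deletes
the first `i` for which the check for `U \ {i}` answers NO. (If no check answers NO, the
algorithm loops forever, and there is no run.) -/
inductive LoopRun {n m : ℕ} (A : Matrix (Fin n) (Fin m) ℝ) (π : Equiv.Perm (Fin m)) :
    Finset (Fin m) → List (Fin m) → Finset (Fin m) → Prop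
  | done (U : Finset (Fin m)) (hU : U.card ≤ n) : LoopRun A π U [] U
  | delete (U W : Finset (Fin m)) (i : Fin m) (D : List (Fin m)) (hU : n < U.card)
      (hi : i ∈ U) (hno : AnswersNo A (U.erase i))
      (hfirst : ∀ j ∈ U, π j < π i → ¬ AnswersNo A (U.erase j))
      (hrest : LoopRun A π (U.erase i) D W) : LoopRun A π U (i :: D) W

/-- `u` is a nonzero vector in the kernel of `A_U` (extended by zero to all columns). -/
def IsKernelVector {n m : ℕ} (A : Matrix (Fin n) (Fin m) ℝ) (U : Finset (Fin m))
    (u : Fin m → ℝ) : Prop :=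
  u ≠ 0 ∧ (∀ i, i ∉ U → u i = 0) ∧ A.mulVec u = 0

/-- A complete run of DerandomizedFind on `A` with scan order `π`: starting from all columns, the
loop deletes the columns in `D` and ends with the set `U`; then a nonzero kernel vector `u` of
`A_U` is found. -/
def IsRun {n m : ℕ} (A : Matrix (Fin n) (Fin m) ℝ) (π : Equiv.Perm (Fin m))
    (D : List (Fin m)) (U : Finset (Fin m)) (u : Fin m → ℝ) : Prop :=
  LoopRun A π Finset.univ D U ∧ IsKernelVector A U u

/-- The subspace `span {A_i : u_i ≠ 0}` that DerandomizedFind computes from the kernel vector. -/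
def foundSubspace {n m : ℕ} (A : Matrix (Fin n) (Fin m) ℝ) (u : Fin m → ℝ) :
    Submodule ℝ (Fin n → ℝ) :=
  Submodule.span ℝ (A.col '' {i | u i ≠ 0})

/-! ### Real RAM programs with a step count

A machine has registers and arrays for natural numbers (used as indices; only addition and
truncated subtraction), and registers and two-dimensional arrays for real numbers (exact
arithmetic and comparison, no rounding). All constants in programs are integers. Every instruction
and every test counts as one step. -/

/-- Memory: natural-number registers and arrays, real registers and two-dimensional arrays. -/
structure State where
  nreg : ℕ → ℕ
  narr : ℕ → ℕ → ℕ
  rreg : ℕ → ℝ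
  rarr : ℕ → ℕ → ℕ → ℝ

/-- Instructions; the arguments name registers (`x y z` natural, `r s t` real) and arrays `a`,
except for the constants `c`. -/
inductive Instr
  | nconst (x c : ℕ)
  | nadd (x y z : ℕ)
  | nsub (x y z : ℕ)
  | nload (x a y : ℕ)
  | nstore (a y x : ℕ)
  | rconst (r : ℕ) (c : ℤ)
  | rofNat (r x : ℕ)
  | radd (r s t : ℕ)
  | rsub (r s t : ℕ)
  | rmul (r s t : ℕ)
  | rdiv (r s t : ℕ)
  | rload (r a x y : ℕ)
  | rstore (a x y r : ℕ)

/-- The effect of an instruction. Division by zero returns zero. -/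
def Instr.apply : Instr → State → State
  | .nconst x c, s => { s with nreg := Function.update s.nreg x c }
  | .nadd x y z, s => { s with nreg := Function.update s.nreg x (s.nreg y + s.nreg z) }
  | .nsub x y z, s => { s with nreg := Function.update s.nreg x (s.nreg y - s.nreg z) }
  | .nload x a y, s => { s with nreg := Function.update s.nreg x (s.narr a (s.nreg y)) }
  | .nstore a y x, s =>
      { s with
        narr := Function.update s.narr a (Function.update (s.narr a) (s.nreg y) (s.nreg x)) }
  | .rconst r c, s => { s with rreg := Function.update s.rreg r (c : ℝ) }
  | .rofNat r x, s => { s with rreg := Function.update s.rreg r (s.nreg x : ℝ) }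
  | .radd r p q, s => { s with rreg := Function.update s.rreg r (s.rreg p + s.rreg q) }
  | .rsub r p q, s => { s with rreg := Function.update s.rreg r (s.rreg p - s.rreg q) }
  | .rmul r p q, s => { s with rreg := Function.update s.rreg r (s.rreg p * s.rreg q) }
  | .rdiv r p q, s => { s with rreg := Function.update s.rreg r (s.rreg p / s.rreg q) }
  | .rload r a x y, s =>
      { s with rreg := Function.update s.rreg r (s.rarr a (s.nreg x) (s.nreg y)) }
  | .rstore a x y r, s =>
      { s with
        rarr := fun b i j =>
          if b = a ∧ i = s.nreg x ∧ j = s.nreg y then s.rreg r else s.rarr b i j }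

/-- Tests: comparison of two natural or of two real registers. -/
inductive Test
  | nlt (x y : ℕ)
  | neq (x y : ℕ)
  | rlt (r s : ℕ)
  | req (r s : ℕ)

/-- The test holds in the given state (`neq`, `req` test equality). -/
def Test.Holds : Test → State → Prop
  | .nlt x y, s => s.nreg x < s.nreg y
  | .neq x y, s => s.nreg x = s.nreg y
  | .rlt p q, s => s.rreg p < s.rreg q
  | .req p q, s => s.rreg p = s.rreg q

/-- Programs: finite, with sequencing, branching and while loops. -/
inductive Prog
  | skip
  | instr (c : Instr)
  | seq (P Q : Prog)
  | cond (b : Test) (P Q : Prog)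
  | loop (b : Test) (P : Prog)

/-- `Exec P s k s'`: started in state `s`, the program `P` halts after exactly `k` steps in
state `s'`. -/
inductive Exec : Prog → State → ℕ → State → Prop
  | skip (s : State) : Exec .skip s 0 s
  | instr (c : Instr) (s : State) : Exec (.instr c) s 1 (c.apply s)
  | seq {P Q : Prog} {s s' s'' : State} {k l : ℕ} (h : Exec P s k s') (h' : Exec Q s' l s'') :
      Exec (.seq P Q) s (k + l) s''
  | condTrue {b : Test} {P Q : Prog} {s s' : State} {k : ℕ} (hb : b.Holds s)
      (h : Exec P s k s') : Exec (.cond b P Q) s (1 + k) s'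
  | condFalse {b : Test} {P Q : Prog} {s s' : State} {k : ℕ} (hb : ¬ b.Holds s)
      (h : Exec Q s k s') : Exec (.cond b P Q) s (1 + k) s'
  | loopDone {b : Test} {P : Prog} {s : State} (hb : ¬ b.Holds s) : Exec (.loop b P) s 1 s
  | loopMore {b : Test} {P : Prog} {s s' s'' : State} {k l : ℕ} (hb : b.Holds s)
      (h : Exec P s k s') (h' : Exec (.loop b P) s' l s'') :
      Exec (.loop b P) s (1 + k + l) s''

/-- Programs are deterministic: step count and final state are determined by the start state. -/
theorem Exec.deterministic {P : Prog} {s s₁ s₂ : State} {k₁ k₂ : ℕ}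
    (h₁ : Exec P s k₁ s₁) (h₂ : Exec P s k₂ s₂) : k₁ = k₂ ∧ s₁ = s₂ := by
  induction h₁ generalizing k₂ s₂ with
  | skip s => cases h₂; exact ⟨rfl, rfl⟩
  | instr c s => cases h₂; exact ⟨rfl, rfl⟩
  | seq _ _ ih ih' =>
    cases h₂ with
    | seq g g' =>
      obtain ⟨rfl, rfl⟩ := ih g
      obtain ⟨rfl, rfl⟩ := ih' g'
      exact ⟨rfl, rfl⟩
  | condTrue hb _ ih =>
    cases h₂ with
    | condTrue _ g => obtain ⟨rfl, rfl⟩ := ih g; exact ⟨rfl, rfl⟩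
    | condFalse hb' _ => exact absurd hb hb'
  | condFalse hb _ ih =>
    cases h₂ with
    | condTrue hb' _ => exact absurd hb' hb
    | condFalse _ g => obtain ⟨rfl, rfl⟩ := ih g; exact ⟨rfl, rfl⟩
  | loopDone hb =>
    cases h₂ with
    | loopDone _ => exact ⟨rfl, rfl⟩
    | loopMore hb' _ _ => exact absurd hb' hb
  | loopMore hb _ _ ih ih' =>
    cases h₂ with
    | loopDone hb' => exact absurd hb hb'
    | loopMore _ g g' =>
      obtain ⟨rfl, rfl⟩ := ih g
      obtain ⟨rfl, rfl⟩ := ih' g'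
      exact ⟨rfl, rfl⟩

/-- The start state on input `A`: `n` and `m` in the natural registers 0 and 1, the entries of `A`
in the real array 0, and zeros everywhere else. -/
def inputState {n m : ℕ} (A : Matrix (Fin n) (Fin m) ℝ) : State where
  nreg := fun x => if x = 0 then n else if x = 1 then m else 0
  narr := fun _ _ => 0
  rreg := fun _ => 0
  rarr := fun a i j => if h : a = 0 ∧ i < n ∧ j < m then A ⟨i, h.2.1⟩ ⟨j, h.2.2⟩ else 0

/-- What is read off the final state: natural array 0 lists the deleted columns `D` in order, real
array 1 holds the kernel vector `u` in its row 0, and natural array 1 is the indicator vector of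
the returned set `L`. -/
def Outputs {m : ℕ} (s : State) (D : List (Fin m)) (u : Fin m → ℝ) (L : Finset (Fin m)) : Prop :=
  (∀ (k : ℕ) (hk : k < D.length), s.narr 0 k = (D[k] : ℕ)) ∧
  (∀ j : Fin m, s.rarr 1 0 j = u j) ∧
  (∀ j : Fin m, s.narr 1 j = if j ∈ L then 1 else 0)

end

end RobustSubspace

namespace RobustSubspace

/-! ### The matroid of the columns -/

/-! Correctness rests on the matroid of the columns. Write L for the inliers. General position and
rank n give, for every set S of at most n columns, that S is independent exactly when |S ∩ L| ≤ d
(`linearIndependent_iff`), and any d inliers span T (`span_eq`). Hence a nonzero kernel vector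
supported on at most n columns uses only inliers, and more than d of them (`support_of_kernel`), so
its support spans T.

On such a matroid the membership check is a count: for |V| ≥ n it answers NO exactly when d|V| < n|V
∩ L| (`answersNo_iff`). The coordinates on the inliers sum to at most d at every point of the
polytope. Conversely, systematic sampling writes the uniform vector as an average of n-sets with at
most d inliers. So a NO answer says that the inlier fraction still exceeds d/n, which is the loop
invariant. Deleting an outlier preserves it, and so does deleting anything once only inliers remain;
the loop is therefore never stuck. At |U| = n the invariant says |U ∩ L| > d, so the remaining
columns are dependent.

For the running time no linear program is solved. The program finds L and d by linear algebra before
the loop starts, and each check then becomes an integer comparison. By averaging, some window of n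
cyclically consecutive columns has more than d inliers (`exists_window`). Gram-Schmidt started at
such a window meets its first dependent column at a position K < n. The K columns before it are
independent and contain exactly d inliers. Reducing all columns against these K rows, while tracking
coefficients, produces kernel vectors on at most n columns, and the union of their supports is L
(`mem_inliers_iff`). The loop is then simulated with counters, and one more orthogonalization of the
n surviving columns supplies the output vector. -/

/-- The assumptions of the theorem on `A`, `T` and `d`. -/
structure InlierModel {n m : ℕ} (A : Matrix (Fin n) (Fin m) ℝ)
    (T : Submodule ℝ (Fin n → ℝ)) (d : ℕ) : Prop where
  pos : 0 < n
  le : n ≤ m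
  rank_eq : A.rank = n
  finrank_eq : Module.finrank ℝ T = d
  general : GeneralPosition A T d
  many : d * m < n * (inliers A T).card

theorem mem_inliers {n m : ℕ} {A : Matrix (Fin n) (Fin m) ℝ} {T : Submodule ℝ (Fin n → ℝ)}
    {i : Fin m} : i ∈ inliers A T ↔ A.col i ∈ T := by
  simp [inliers]

namespace InlierModel

variable {n m d : ℕ} {A : Matrix (Fin n) (Fin m) ℝ} {T : Submodule ℝ (Fin n → ℝ)}

theorem dim_lt (h : InlierModel A T d) : d < n := by
  have h1 : (inliers A T).card ≤ m := by simpa using Finset.card_le_univ (inliers A T)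
  have h2 := h.many
  have h3 : d * m < n * m := h2.trans_le (Nat.mul_le_mul_left n h1)
  exact lt_of_mul_lt_mul_right h3 (Nat.zero_le m)

theorem dim_le_card (h : InlierModel A T d) : d ≤ (inliers A T).card := by
  have h2 := h.many
  have h3 : d * n < (inliers A T).card * n := by
    calc d * n ≤ d * m := Nat.mul_le_mul_left d h.le
      _ < _ := by rw [mul_comm _ n]; exact h2
  exact (lt_of_mul_lt_mul_right h3 (Nat.zero_le n)).le

/-- T and the outlier columns together contain all columns, so rank n forces the outliers to supply
the dimensions missing from T. This leaves enough outliers to enlarge a set to n elements without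
exceeding d inliers. -/
theorem le_dim_add_outliers (h : InlierModel A T d) : n ≤ d + (inliers A T)ᶜ.card := by
  have htop : Submodule.span ℝ (Set.range A.col) = ⊤ := by
    apply Submodule.eq_top_of_finrank_eq
    rw [← Matrix.rank_eq_finrank_span_cols, h.rank_eq]
    simp
  have hle : (⊤ : Submodule ℝ (Fin n → ℝ)) ≤
      T ⊔ Submodule.span ℝ (((inliers A T)ᶜ.image A.col : Finset (Fin n → ℝ)) :
        Set (Fin n → ℝ)) := by
    rw [← htop, Submodule.span_le]
    rintro _ ⟨i, rfl⟩
    by_cases hi : A.col i ∈ T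
    · exact Submodule.mem_sup_left hi
    · refine Submodule.mem_sup_right (Submodule.subset_span ?_)
      simp only [Finset.coe_image]
      exact ⟨i, by simpa [mem_inliers] using hi, rfl⟩
  have h1 := Submodule.finrank_mono hle
  have h2 := Submodule.finrank_add_le_finrank_add_finrank T (Submodule.span ℝ
    (((inliers A T)ᶜ.image A.col : Finset (Fin n → ℝ)) : Set (Fin n → ℝ)))
  have h3 := finrank_span_finset_le_card (R := ℝ) ((inliers A T)ᶜ.image A.col)
  have h4 : ((inliers A T)ᶜ.image A.col).card ≤ _ := Finset.card_image_le
  have h5 : Module.finrank ℝ (⊤ : Submodule ℝ (Fin n → ℝ)) = n := by simp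
  have h6 := h.finrank_eq
  simp only [Set.finrank] at h3
  omega

/-- Extends general position from n-sets to smaller sets. Independent inliers live in T, whence the
bound d. Conversely, S is enlarged to an n-set V that still has at most d inliers, and independence
passes from V to its subset. -/
theorem linearIndependent_iff (h : InlierModel A T d) {S : Finset (Fin m)} (hS : S.card ≤ n) :
    LinearIndependent ℝ (fun i : S => A.col i) ↔ (S ∩ inliers A T).card ≤ d := by
  classical
  constructor
  · intro hi
    have h1 : LinearIndependent ℝ (fun i : ↥(S ∩ inliers A T) => A.col i) :=
      hi.comp (fun i : ↥(S ∩ inliers A T) => (⟨i, (Finset.mem_inter.1 i.2).1⟩ : S))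
        (fun a b hab => Subtype.ext (congrArg (fun z : S => (z : Fin m)) hab))
    have h2 : LinearIndependent ℝ
        (fun i : ↥(S ∩ inliers A T) => (⟨A.col i, mem_inliers.1 (Finset.mem_inter.1 i.2).2⟩ : T)) :=
      LinearIndependent.of_comp T.subtype h1
    have h3 := h2.fintype_card_le_finrank
    rwa [h.finrank_eq, Fintype.card_coe] at h3
  · intro hc
    obtain ⟨Y, hY1, hY2, hY3⟩ := Finset.exists_subsuperset_card_eq
      (Finset.inter_subset_right : S ∩ inliers A T ⊆ inliers A T) hc h.dim_le_card
    have hsub : S ⊆ Y ∪ (inliers A T)ᶜ := by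
      intro i hi
      by_cases hL : i ∈ inliers A T
      · exact Finset.mem_union_left _ (hY1 (Finset.mem_inter.2 ⟨hi, hL⟩))
      · exact Finset.mem_union_right _ (Finset.mem_compl.2 hL)
    have hcard : n ≤ (Y ∪ (inliers A T)ᶜ).card := by
      rw [Finset.card_union_of_disjoint, hY3]
      · exact h.le_dim_add_outliers
      · exact Finset.disjoint_of_subset_left hY2 disjoint_compl_right
    obtain ⟨V, hV1, hV2, hV3⟩ := Finset.exists_subsuperset_card_eq hsub hS hcard
    have hV : LinearIndependent ℝ (fun i : V => A.col i) := by
      rw [h.general V hV3, ← hY3]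
      apply Finset.card_le_card
      intro i hi
      obtain ⟨hi1, hi2⟩ := Finset.mem_inter.1 hi
      rcases Finset.mem_union.1 (hV2 hi1) with hy | hy
      · exact hy
      · exact absurd hi2 (Finset.mem_compl.1 hy)
    exact hV.comp (fun i : S => (⟨i, hV1 i.2⟩ : V))
      (fun a b hab => Subtype.ext (congrArg (fun z : V => (z : Fin m)) hab))

/-- Any d of the inliers in S are independent, so they fill the d-dimensional space T. -/
theorem span_eq (h : InlierModel A T d) {S : Finset (Fin m)} (hS : S ⊆ inliers A T)
    (hc : d ≤ S.card) : Submodule.span ℝ (A.col '' (S : Set (Fin m))) = T := by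
  have hle : Submodule.span ℝ (A.col '' (S : Set (Fin m))) ≤ T := by
    rw [Submodule.span_le]
    rintro _ ⟨i, hi, rfl⟩
    exact mem_inliers.1 (hS hi)
  apply Submodule.eq_of_le_of_finrank_le hle
  rw [h.finrank_eq]
  obtain ⟨Y, hY1, hY2⟩ := Finset.exists_subset_card_eq hc
  have hYi : LinearIndependent ℝ (fun i : Y => A.col i) := by
    rw [h.linearIndependent_iff (hY2.trans_le h.dim_lt.le), ← hY2]
    exact Finset.card_le_card Finset.inter_subset_left
  have h1 := finrank_span_eq_card hYi
  have h2 : Submodule.span ℝ (Set.range (fun i : Y => A.col i)) ≤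
      Submodule.span ℝ (A.col '' (S : Set (Fin m))) := by
    apply Submodule.span_mono
    rintro _ ⟨i, rfl⟩
    exact ⟨i, hY1 i.2, rfl⟩
  have h3 := Submodule.finrank_mono h2
  rw [h1] at h3
  simpa [hY2] using h3

end InlierModel

/-! ### Kernel vectors supported on few columns. -/

theorem mulVec_eq_sum_cols {n m : ℕ} (A : Matrix (Fin n) (Fin m) ℝ) (w : Fin m → ℝ) :
    A.mulVec w = ∑ i, w i • A.col i := by
  ext x
  simp [Matrix.mulVec, dotProduct, mul_comm]

/-- A nonzero kernel vector supported on `S` exists if and only if the columns in `S` are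
linearly dependent. -/
theorem exists_isKernelVector_iff {n m : ℕ} {A : Matrix (Fin n) (Fin m) ℝ} {S : Finset (Fin m)} :
    (∃ w, IsKernelVector A S w) ↔ ¬ LinearIndependent ℝ (fun i : S => A.col i) := by
  classical
  constructor
  · rintro ⟨w, hw0, hwS, hw⟩ hi
    rw [Fintype.linearIndependent_iff] at hi
    apply hw0
    funext i
    by_cases hiS : i ∈ S
    · refine hi (fun i => w i) ?_ ⟨i, hiS⟩
      rw [mulVec_eq_sum_cols] at hw
      rw [Finset.sum_coe_sort S (fun i => w i • A.col i), ← hw]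
      apply Finset.sum_subset (Finset.subset_univ S)
      intro x _ hx
      simp [hwS x hx]
    · exact hwS i hiS
  · intro hi
    rw [Fintype.linearIndependent_iff] at hi
    push Not at hi
    obtain ⟨g, hg, i, hgi⟩ := hi
    refine ⟨fun j => if hj : j ∈ S then g ⟨j, hj⟩ else 0, ?_, ?_, ?_⟩
    · intro h0
      apply hgi
      simpa using congrFun h0 i
    · intro j hj
      simp [hj]
    · rw [mulVec_eq_sum_cols, ← hg,
        ← Finset.sum_subset (Finset.subset_univ S), ← Finset.sum_coe_sort S]
      · simp
      · intro x _ hx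
        simp [hx]

namespace InlierModel

variable {n m d : ℕ} {A : Matrix (Fin n) (Fin m) ℝ} {T : Submodule ℝ (Fin n → ℝ)}

open Classical in
/-- The support of a nonzero kernel vector on at most `n` columns consists of more than `d`
inliers. -/
theorem support_of_kernel (h : InlierModel A T d) {U : Finset (Fin m)} (hU : U.card ≤ n)
    {w : Fin m → ℝ} (hw : IsKernelVector A U w) :
    (Finset.univ.filter fun i => w i ≠ 0) ⊆ inliers A T ∧
      d < (Finset.univ.filter fun i => w i ≠ 0).card := by
  set S := Finset.univ.filter fun i => w i ≠ 0 with hSdef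
  have hSU : S ⊆ U := by
    intro i hi
    by_contra hn
    simp only [hSdef, Finset.mem_filter, Finset.mem_univ, true_and] at hi
    exact hi (hw.2.1 i hn)
  have hScard : S.card ≤ n := (Finset.card_le_card hSU).trans hU
  have hkS : IsKernelVector A S w := by
    refine ⟨hw.1, fun i hi => ?_, hw.2.2⟩
    by_contra hn
    exact hi (by simp [hSdef, hn])
  have hdep := exists_isKernelVector_iff.1 ⟨w, hkS⟩
  rw [h.linearIndependent_iff hScard, not_le] at hdep
  refine ⟨?_, hdep.trans_le (Finset.card_le_card Finset.inter_subset_left)⟩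
  intro i hi
  by_contra hiL
  -- Suppose the outlier i is in the support. Keeping only d of the inliers of S leaves an
  -- independent set that still spans every column of the support: the kept inliers Y span T, and
  -- the outliers are all kept. The kernel relation then expresses column i through the others.
  obtain ⟨Y, hY1, hY2⟩ := Finset.exists_subset_card_eq hdep.le
  have hYL : Y ⊆ inliers A T := hY1.trans Finset.inter_subset_right
  have hYT := h.span_eq hYL hY2.ge
  -- the set `Y ∪ (S \ L)` is independent, but the column `i` lies in the span of the others
  set Z := Y ∪ (S \ inliers A T) with hZ
  have hZcard : Z.card ≤ n := by
    have h1 : Z.card ≤ Y.card + (S \ inliers A T).card := Finset.card_union_le _ _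
    have h2 := Finset.card_sdiff_add_card_inter S (inliers A T)
    omega
  have hZL : (Z ∩ inliers A T).card ≤ d := by
    rw [← hY2]
    apply Finset.card_le_card
    intro j hj
    obtain ⟨hj1, hj2⟩ := Finset.mem_inter.1 hj
    rcases Finset.mem_union.1 hj1 with hy | hy
    · exact hy
    · exact absurd hj2 (Finset.mem_sdiff.1 hy).2
  have hind := (h.linearIndependent_iff hZcard).2 hZL
  have hiZ : i ∈ Z := Finset.mem_union_right _ (Finset.mem_sdiff.2 ⟨hi, hiL⟩)
  have hnot := hind.notMem_span_image (s := {j : Z | (j : Fin m) ≠ i}) (x := ⟨i, hiZ⟩) (by simp)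
  apply hnot
  set W := Submodule.span ℝ ((fun j : Z => A.col j) '' {j : Z | (j : Fin m) ≠ i}) with hW
  have hTW : T ≤ W := by
    rw [← hYT, Submodule.span_le]
    rintro _ ⟨j, hj, rfl⟩
    refine Submodule.subset_span ⟨⟨j, Finset.mem_union_left _ hj⟩, ?_, rfl⟩
    rintro rfl
    exact hiL (hYL hj)
  have hsum := hw.2.2
  rw [mulVec_eq_sum_cols, ← Finset.add_sum_erase _ _ (Finset.mem_univ i)] at hsum
  have hrest : ∑ j ∈ Finset.univ.erase i, w j • A.col j ∈ W := by
    refine Submodule.sum_mem _ fun j hj => ?_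
    by_cases hwj : w j = 0
    · simp [hwj]
    · apply W.smul_mem
      by_cases hjL : j ∈ inliers A T
      · exact hTW (mem_inliers.1 hjL)
      · refine Submodule.subset_span ⟨⟨j, Finset.mem_union_right _ (Finset.mem_sdiff.2
          ⟨by simp [hSdef, hwj], hjL⟩)⟩, ?_, rfl⟩
        simpa using (Finset.mem_erase.1 hj).1
  have hwi : w i ≠ 0 := by simpa [hSdef] using hi
  have hmem : w i • A.col i ∈ W := by
    rw [eq_neg_of_add_eq_zero_left hsum]
    exact W.neg_mem hrest
  exact (W.smul_mem_iff hwi).1 hmem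

theorem foundSubspace_eq (h : InlierModel A T d) {U : Finset (Fin m)} (hU : U.card ≤ n)
    {w : Fin m → ℝ} (hw : IsKernelVector A U w) : foundSubspace A w = T := by
  classical
  obtain ⟨h1, h2⟩ := h.support_of_kernel hU hw
  have := h.span_eq h1 h2.le
  simpa [foundSubspace] using this

end InlierModel

/-! ### The membership check on a uniform vector -/

/-- A form of Hermite's identity: raising a by one shifts the range of summation, which loses the
term a / v and gains a / v + 1. It makes the rounding in systematic sampling average out exactly. -/
theorem sum_add_div (v : ℕ) (hv : 0 < v) (a : ℕ) : ∑ θ ∈ Finset.range v, (a + θ) / v = a := by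
  induction a with
  | zero =>
    apply Finset.sum_eq_zero
    intro θ hθ
    simpa using Nat.div_eq_of_lt (Finset.mem_range.1 hθ)
  | succ a ih =>
    have h1 := Finset.sum_range_succ (fun θ => (a + θ) / v) v
    have h2 := Finset.sum_range_succ' (fun θ => (a + θ) / v) v
    rw [h1, ih, Nat.add_div_right _ hv] at h2
    have h3 : ∑ θ ∈ Finset.range v, (a + (θ + 1)) / v =
        ∑ θ ∈ Finset.range v, (a + 1 + θ) / v :=
      Finset.sum_congr rfl fun θ _ => by congr 1; ring
    simp only [h3, add_zero] at h2
    omega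

/-- Systematic sampling: the uniform vector with entries `n / v` is an average of indicators of
`n`-element sets whose intersections with an initial segment differ by less than one from the
expected value. -/
theorem uniform_mem_convexHull_fin {n v l d : ℕ} (hn : n ≤ v) (hv : 0 < v) (hl : l ≤ v)
    (hd : n * l ≤ d * v) :
    (fun _ : Fin v => (n : ℝ) / v) ∈ convexHull ℝ {x : Fin v → ℝ | ∃ U : Finset (Fin v),
      U.card = n ∧ (U.filter fun i : Fin v => (i : ℕ) < l).card ≤ d ∧
      x = Set.indicator (U : Set (Fin v)) 1} := by
  classical
  -- For the offset θ, element i is sampled when (i n + θ) / v jumps between i and i + 1. Since n ≤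
  -- v each jump is at most one, so for θ < v exactly `f θ k` elements below k are sampled.
  let f : ℕ → ℕ → ℕ := fun θ i => (i * n + θ) / v
  have hf1 : ∀ θ i, f θ (i + 1) = f θ i ∨ f θ (i + 1) = f θ i + 1 := by
    intro θ i
    have h1 : f θ i ≤ f θ (i + 1) := Nat.div_le_div_right (by ring_nf; omega)
    have h2 : f θ (i + 1) ≤ f θ i + 1 := by
      have : f θ i + 1 = (i * n + θ + v) / v := (Nat.add_div_right _ hv).symm
      rw [this]
      exact Nat.div_le_div_right (by ring_nf; omega)
    omega
  let U : ℕ → Finset (Fin v) := fun θ => Finset.univ.filter fun i => f θ (i + 1) = f θ i + 1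
  have hsum : ∀ θ k, k ≤ v → ((U θ).filter fun i : Fin v => (i : ℕ) < k).card + f θ 0 = f θ k := by
    intro θ k hk
    induction k with
    | zero => simp
    | succ k ih =>
      have hk' : k < v := hk
      have h1 := ih hk'.le
      by_cases hc : f θ (k + 1) = f θ k + 1
      · have : ((U θ).filter fun i : Fin v => (i : ℕ) < k + 1) =
            insert (⟨k, hk'⟩ : Fin v) ((U θ).filter fun i : Fin v => (i : ℕ) < k) := by
          ext i
          simp only [U, Finset.mem_filter, Finset.mem_univ, true_and, Finset.mem_insert,
            Fin.ext_iff]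
          constructor
          · rintro ⟨ha, hb⟩
            by_cases hik : (i : ℕ) = k
            · exact Or.inl hik
            · exact Or.inr ⟨ha, by omega⟩
          · rintro (ha | ⟨ha, hb⟩)
            · rw [ha]; exact ⟨hc, by omega⟩
            · exact ⟨ha, by omega⟩
        rw [this, Finset.card_insert_of_notMem (by simp)]
        omega
      · have h2 := hf1 θ k
        have : ((U θ).filter fun i : Fin v => (i : ℕ) < k + 1) =
            ((U θ).filter fun i : Fin v => (i : ℕ) < k) := by
          ext i
          simp only [U, Finset.mem_filter, Finset.mem_univ, true_and]
          constructor
          · rintro ⟨ha, hb⟩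
            refine ⟨ha, ?_⟩
            by_contra hik
            have : (i : ℕ) = k := by omega
            rw [this] at ha
            exact hc ha
          · rintro ⟨ha, hb⟩
            exact ⟨ha, by omega⟩
        rw [this]
        omega
  have hf0 : ∀ θ < v, f θ 0 = 0 := fun θ hθ => by simpa [f] using Nat.div_eq_of_lt hθ
  -- The indicator of `U θ` at i is the difference of `f θ` at i + 1 and i; by `sum_add_div` these
  -- differences sum over θ to (i + 1) n - i n = n.
  have hx : (fun _ : Fin v => (n : ℝ) / v) =
      ∑ θ ∈ Finset.range v, (1 / (v : ℝ)) • (Set.indicator (U θ : Set (Fin v)) 1 : Fin v → ℝ) := by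
    funext i
    have h1 : ∀ θ, (Set.indicator (U θ : Set (Fin v)) 1 : Fin v → ℝ) i =
        (f θ (i + 1) : ℝ) - f θ i := by
      intro θ
      by_cases hc : f θ (i + 1) = f θ i + 1
      · rw [Set.indicator_of_mem (by simpa [U] using hc), hc]; simp
      · have h2 := (hf1 θ i).resolve_right hc
        rw [Set.indicator_of_notMem (by simpa [U] using hc), h2]; simp
    simp only [Finset.sum_apply, Pi.smul_apply, h1, smul_eq_mul]
    rw [← Finset.mul_sum, Finset.sum_sub_distrib, ← Nat.cast_sum, ← Nat.cast_sum,
      sum_add_div v hv, sum_add_div v hv]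
    push_cast
    ring
  rw [hx]
  refine (convex_convexHull ℝ _).sum_mem (fun _ _ => by positivity) ?_ fun θ hθ => ?_
  · have : (v : ℝ) ≠ 0 := by positivity
    simp [this]
  · have hθ := Finset.mem_range.1 hθ
    refine subset_convexHull ℝ _ ⟨U θ, ?_, ?_, rfl⟩
    · have h1 := hsum θ v le_rfl
      have h2 : (U θ).filter (fun i : Fin v => (i : ℕ) < v) = U θ := by
        apply Finset.filter_true_of_mem
        intro i _
        exact i.2
      rw [h2, hf0 θ hθ] at h1
      have h3 : f θ v = n := by
        simp only [f]
        rw [Nat.mul_add_div hv, Nat.div_eq_of_lt hθ]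
        rfl
      omega
    -- From l n ≤ d v and θ < v the quotient (l n + θ) / v is below d + 1.
    · have h1 := hsum θ l hl
      rw [hf0 θ hθ] at h1
      have h2 : f θ l < d + 1 := by
        simp only [f]
        rw [Nat.div_lt_iff_lt_mul hv]
        nlinarith
      omega

/-- `uniform_mem_convexHull_fin` for an arbitrary set of marked elements. -/
theorem uniform_mem_convexHull {ι : Type*} [Fintype ι] {n d : ℕ} (p : ι → Prop) [DecidablePred p]
    (hn : n ≤ Fintype.card ι) (hv : 0 < Fintype.card ι)
    (hd : n * (Finset.univ.filter p).card ≤ d * Fintype.card ι) :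
    (fun _ : ι => (n : ℝ) / Fintype.card ι) ∈ convexHull ℝ {x : ι → ℝ | ∃ U : Finset ι,
      U.card = n ∧ (U.filter p).card ≤ d ∧ x = Set.indicator (U : Set ι) 1} := by
  classical
  obtain ⟨l, hl⟩ : ∃ l, l = Fintype.card {i // p i} := ⟨_, rfl⟩
  obtain ⟨r, hr⟩ : ∃ r, r = Fintype.card {i // ¬ p i} := ⟨_, rfl⟩
  -- This enumeration lists the marked elements before all others, so that they become the initial
  -- segment of length l.
  let e : ι ≃ Fin (l + r) := (Equiv.sumCompl p).symm.trans
    ((Equiv.sumCongr (Fintype.equivFinOfCardEq hl.symm)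
      (Fintype.equivFinOfCardEq hr.symm)).trans finSumFinEquiv)
  have he : ∀ i, ((e i : Fin (l + r)) : ℕ) < l ↔ p i := by
    intro i
    by_cases hi : p i
    · simp [e, Equiv.sumCompl_symm_apply_of_pos hi, hi]
    · simp [e, Equiv.sumCompl_symm_apply_of_neg hi, hi]
  have hcard : Fintype.card ι = l + r := by simpa using Fintype.card_congr e
  have hpl : (Finset.univ.filter p).card = l := by rw [hl, Fintype.card_subtype]
  rw [hcard] at hn hv hd
  rw [hpl] at hd
  have key := uniform_mem_convexHull_fin hn hv (Nat.le_add_right l r) hd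
  have himg := Set.mem_image_of_mem (LinearMap.funLeft ℝ ℝ e) key
  rw [LinearMap.image_convexHull] at himg
  rw [hcard]
  refine convexHull_mono ?_ himg
  rintro _ ⟨_, ⟨U, hU1, hU2, rfl⟩, rfl⟩
  refine ⟨U.map e.symm.toEmbedding, by simpa using hU1, ?_, ?_⟩
  · rw [Finset.filter_map, Finset.card_map]
    convert hU2 using 3 with i
    simp [← he]
  · funext i
    simp only [LinearMap.funLeft_apply, Set.indicator, Finset.coe_map, Equiv.coe_toEmbedding,
      Set.mem_image, Finset.mem_coe, Pi.one_apply]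
    congr 1
    apply propext
    constructor
    · intro hi; exact ⟨_, hi, by simp⟩
    · rintro ⟨a, ha, rfl⟩; simpa using ha

theorem finrank_span_colsOn_eq_card_iff {n m : ℕ} {A : Matrix (Fin n) (Fin m) ℝ} {V : Finset (Fin m)}
    {U : Finset V} :
    (Module.finrank ℝ (Submodule.span ℝ ((colsOn A V).col '' (U : Set V))) = U.card) ↔
      LinearIndependent ℝ (fun i : ↥(U.map (Function.Embedding.subtype _)) => A.col i) := by
  classical
  rw [linearIndependent_iff_card_eq_finrank_span, Set.finrank]
  have : (colsOn A V).col '' (U : Set V) =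
      Set.range (fun i : ↥(U.map (Function.Embedding.subtype _)) => A.col i) := by
    ext y
    constructor
    · rintro ⟨i, hi, rfl⟩
      exact ⟨⟨i, Finset.mem_map_of_mem _ hi⟩, rfl⟩
    · rintro ⟨⟨i, hi⟩, rfl⟩
      obtain ⟨j, hj, rfl⟩ := Finset.mem_map.1 hi
      exact ⟨j, hj, rfl⟩
  rw [this, Fintype.card_coe, Finset.card_map, eq_comm]

namespace InlierModel

variable {n m d : ℕ} {A : Matrix (Fin n) (Fin m) ℝ} {T : Submodule ℝ (Fin n → ℝ)}

theorem map_inter_inliers (V : Finset (Fin m)) (U : Finset V)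
    [DecidablePred fun i : V => (i : Fin m) ∈ inliers A T] :
    (U.map (Function.Embedding.subtype _) ∩ inliers A T).card =
      (U.filter fun i : V => (i : Fin m) ∈ inliers A T).card := by
  classical
  rw [← Finset.filter_mem_eq_inter, Finset.filter_map, Finset.card_map]
  congr 1
  ext
  rw [Finset.mem_filter, Finset.mem_filter]
  rfl

/-- Only the constraint from T can exclude the uniform vector: an independent set has at most d
inliers, so membership forces n|V ∩ L|/|V| ≤ d. When this bound holds, the sets from
`uniform_mem_convexHull` are independent n-sets, and the uniform vector is in their convex hull. -/
theorem answersNo_iff (h : InlierModel A T d) {V : Finset (Fin m)} (hV : n ≤ V.card) :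
    AnswersNo A V ↔ d * V.card < n * (V ∩ inliers A T).card := by
  classical
  have hpos : 0 < V.card := h.pos.trans_le hV
  have hposR : (0 : ℝ) < V.card := by exact_mod_cast hpos
  have hfil : (V ∩ inliers A T).card =
      (Finset.univ.filter fun i : V => (i : Fin m) ∈ inliers A T).card := by
    rw [← map_inter_inliers]
    congr 2
    ext; simp
  rw [AnswersNo, ← not_le, not_iff_not]
  constructor
  · rintro ⟨hx, -⟩
    -- every point of the polytope has at most `d` units on the inliers
    let φ : (V → ℝ) →ₗ[ℝ] ℝ := ∑ i ∈ Finset.univ.filter (fun i : V => (i : Fin m) ∈ inliers A T),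
      LinearMap.proj i
    have hconv : Convex ℝ {x : V → ℝ | φ x ≤ d} := convex_halfSpace_le φ.isLinear _
    have hsub := convexHull_min (t := {x : V → ℝ | φ x ≤ d}) ?_ hconv hx
    · simp only [Set.mem_ofPred_eq, φ, LinearMap.sum_apply, LinearMap.proj_apply,
        Finset.sum_const, nsmul_eq_mul] at hsub
      rw [← hfil, ← mul_div_assoc, div_le_iff₀ hposR] at hsub
      have : n * (V ∩ inliers A T).card ≤ d * V.card := by
        rw [mul_comm n]; exact_mod_cast hsub
      exact this
    · rintro _ ⟨U, hU, rfl⟩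
      have hcard : U.card ≤ n := by
        rw [← hU]
        exact (Submodule.finrank_le _).trans (by simp)
      rw [finrank_span_colsOn_eq_card_iff, h.linearIndependent_iff (by simpa using hcard),
        map_inter_inliers] at hU
      simp only [Set.mem_ofPred_eq, φ, LinearMap.sum_apply, LinearMap.proj_apply]
      have : ∑ i ∈ Finset.univ.filter (fun i : V => (i : Fin m) ∈ inliers A T),
          (Set.indicator (U : Set V) 1 : V → ℝ) i =
          ((U.filter fun i : V => (i : Fin m) ∈ inliers A T).card : ℝ) := by
        simp only [Set.indicator, Finset.mem_coe, Pi.one_apply]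
        rw [Finset.sum_boole, Finset.filter_filter]
        congr 2
        ext i
        simp [and_comm]
      rw [this]
      exact_mod_cast hU
  · intro hle
    refine ⟨?_, ?_⟩
    · have key := uniform_mem_convexHull (n := n) (d := d) (fun i : V => (i : Fin m) ∈ inliers A T)
        (by simpa using hV) (by simpa using hpos) (by rw [← hfil]; simpa using hle)
      simp only [Fintype.card_coe] at key
      refine convexHull_mono ?_ key
      rintro _ ⟨U, hU1, hU2, rfl⟩
      refine ⟨U, ?_, rfl⟩
      rw [finrank_span_colsOn_eq_card_iff, h.linearIndependent_iff (by simpa using hU1.le),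
        map_inter_inliers]
      exact hU2
    · simp only [Finset.sum_const, nsmul_eq_mul, Finset.card_univ, Fintype.card_coe]
      field_simp

end InlierModel

/-! ### Correctness of the algorithm -/

namespace InlierModel

variable {n m d : ℕ} {A : Matrix (Fin n) (Fin m) ℝ} {T : Submodule ℝ (Fin n → ℝ)}

/-- The NO answer for `U.erase i` is itself the invariant for the next set, whichever element was
deleted. At size n the common factor n cancels. -/
theorem loop_invariant (h : InlierModel A T d) {π : Equiv.Perm (Fin m)} {U W : Finset (Fin m)}
    {D : List (Fin m)} (hrun : LoopRun A π U D W) (hU : n ≤ U.card)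
    (hinv : d * U.card < n * (U ∩ inliers A T).card) :
    W.card = n ∧ d < (W ∩ inliers A T).card := by
  induction hrun with
  | done U hle =>
    have hc : U.card = n := le_antisymm hle hU
    refine ⟨hc, ?_⟩
    rw [hc, mul_comm] at hinv
    exact lt_of_mul_lt_mul_left hinv (Nat.zero_le n)
  | delete U W i D hgt hi hno hfirst hrest ih =>
    have hc := Finset.card_erase_of_mem hi
    have hge : n ≤ (U.erase i).card := by omega
    exact ih hge ((h.answersNo_iff hge).1 hno)

/-- If U contains an outlier, deleting it keeps the inlier count and does not increase the left
side. If U consists of inliers, the inequality for any deletion reduces to d < n. -/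
theorem exists_answersNo (h : InlierModel A T d) {U : Finset (Fin m)} (hU : n < U.card)
    (hinv : d * U.card < n * (U ∩ inliers A T).card) : ∃ i ∈ U, AnswersNo A (U.erase i) := by
  by_cases hsub : U ⊆ inliers A T
  · have hpos : 0 < U.card := by omega
    obtain ⟨i, hi⟩ := Finset.card_pos.1 hpos
    refine ⟨i, hi, ?_⟩
    have hc := Finset.card_erase_of_mem hi
    rw [h.answersNo_iff (by omega),
      Finset.inter_eq_left.2 ((Finset.erase_subset i U).trans hsub)]
    apply Nat.mul_lt_mul_of_pos_right h.dim_lt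
    have := h.pos
    omega
  · obtain ⟨i, hi, hiL⟩ := Finset.not_subset.1 hsub
    refine ⟨i, hi, ?_⟩
    have hc := Finset.card_erase_of_mem hi
    rw [h.answersNo_iff (by omega)]
    have : U.erase i ∩ inliers A T = U ∩ inliers A T := by
      rw [Finset.erase_inter, Finset.erase_eq_of_notMem]
      simp [hiL]
    rw [this]
    exact (Nat.mul_le_mul_left d (by omega)).trans_lt hinv

theorem exists_loopRun (h : InlierModel A T d) (π : Equiv.Perm (Fin m)) (k : ℕ)
    {U : Finset (Fin m)} (hU : U.card = n + k)
    (hinv : d * U.card < n * (U ∩ inliers A T).card) : ∃ D W, LoopRun A π U D W := by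
  classical
  induction k generalizing U with
  | zero => exact ⟨[], U, .done U (by omega)⟩
  | succ k ih =>
    have hlt : n < U.card := by omega
    obtain ⟨i₀, hi₀, hno₀⟩ := h.exists_answersNo hlt hinv
    obtain ⟨i, hi, hmin⟩ := Finset.exists_min_image (U.filter fun i => AnswersNo A (U.erase i)) π
      ⟨i₀, Finset.mem_filter.2 ⟨hi₀, hno₀⟩⟩
    obtain ⟨hiU, hno⟩ := Finset.mem_filter.1 hi
    have hc := Finset.card_erase_of_mem hiU
    obtain ⟨D, W, hDW⟩ := ih (U := U.erase i) (by omega) ((h.answersNo_iff (by omega)).1 hno)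
    refine ⟨i :: D, W, .delete U W i D hlt hiU hno (fun j hj hji hnoj => ?_) hDW⟩
    exact absurd (hmin j (Finset.mem_filter.2 ⟨hj, hnoj⟩)) (not_le.2 hji)

theorem univ_invariant (h : InlierModel A T d) :
    d * (Finset.univ : Finset (Fin m)).card <
      n * ((Finset.univ : Finset (Fin m)) ∩ inliers A T).card := by
  simpa using h.many

theorem loopRun_univ (h : InlierModel A T d) {π : Equiv.Perm (Fin m)} {D : List (Fin m)}
    {U : Finset (Fin m)} (hrun : LoopRun A π Finset.univ D U) :
    U.card = n ∧ d < (U ∩ inliers A T).card :=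
  h.loop_invariant hrun (by simpa using h.le) h.univ_invariant

theorem exists_isRun (h : InlierModel A T d) (π : Equiv.Perm (Fin m)) :
    ∃ D U u, IsRun A π D U u := by
  have hle := h.le
  obtain ⟨D, U, hrun⟩ := h.exists_loopRun π (m - n) (U := Finset.univ)
    (by simp only [Finset.card_univ, Fintype.card_fin]; omega) h.univ_invariant
  obtain ⟨hc, hd⟩ := h.loopRun_univ hrun
  have hdep : ¬ LinearIndependent ℝ (fun i : U => A.col i) := by
    rw [h.linearIndependent_iff hc.le]
    omega
  obtain ⟨u, hu⟩ := exists_isKernelVector_iff.2 hdep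
  exact ⟨D, U, u, hrun, hu⟩

theorem foundSubspace_of_isRun (h : InlierModel A T d) {π : Equiv.Perm (Fin m)}
    {D : List (Fin m)} {U : Finset (Fin m)} {u : Fin m → ℝ} (hrun : IsRun A π D U u) :
    foundSubspace A u = T :=
  h.foundSubspace_eq (h.loopRun_univ hrun.1).1.le hrun.2

end InlierModel

/-! ### Reasoning about programs -/

/-- The natural registers written by an instruction. -/
def Instr.nregs : Instr → List ℕ
  | .nconst x _ | .nadd x _ _ | .nsub x _ _ | .nload x _ _ => [x]
  | _ => []

/-- The natural arrays written by an instruction. -/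
def Instr.narrs : Instr → List ℕ
  | .nstore a _ _ => [a]
  | _ => []

/-- The real registers written by an instruction. -/
def Instr.rregs : Instr → List ℕ
  | .rconst r _ | .rofNat r _ | .radd r _ _ | .rsub r _ _ | .rmul r _ _ | .rdiv r _ _
  | .rload r _ _ _ => [r]
  | _ => []

/-- The real arrays written by an instruction. -/
def Instr.rarrs : Instr → List ℕ
  | .rstore a _ _ _ => [a]
  | _ => []

/-- All values of `f` at the instructions of a program. -/
def Prog.collect (f : Instr → List ℕ) : Prog → List ℕ
  | .skip => []
  | .instr c => f c
  | .seq P Q => P.collect f ++ Q.collect f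
  | .cond _ P Q => P.collect f ++ Q.collect f
  | .loop _ P => P.collect f

/-- The two states agree outside of the registers and arrays that `P` writes. -/
structure SameOutside (P : Prog) (s s' : State) : Prop where
  nreg : ∀ x, x ∉ P.collect Instr.nregs → s'.nreg x = s.nreg x
  narr : ∀ a, a ∉ P.collect Instr.narrs → s'.narr a = s.narr a
  rreg : ∀ x, x ∉ P.collect Instr.rregs → s'.rreg x = s.rreg x
  rarr : ∀ a, a ∉ P.collect Instr.rarrs → s'.rarr a = s.rarr a

namespace SameOutside

theorem refl (P : Prog) (s : State) : SameOutside P s s :=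
  ⟨fun _ _ => rfl, fun _ _ => rfl, fun _ _ => rfl, fun _ _ => rfl⟩

theorem trans {P : Prog} {s s' s'' : State} (h : SameOutside P s s') (h' : SameOutside P s' s'') :
    SameOutside P s s'' :=
  ⟨fun x hx => (h'.nreg x hx).trans (h.nreg x hx), fun x hx => (h'.narr x hx).trans (h.narr x hx),
    fun x hx => (h'.rreg x hx).trans (h.rreg x hx), fun x hx => (h'.rarr x hx).trans (h.rarr x hx)⟩

theorem mono {P Q : Prog} {s s' : State} (h : SameOutside P s s')
    (hsub : ∀ f, P.collect f ⊆ Q.collect f) : SameOutside Q s s' :=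
  ⟨fun x hx => h.nreg x fun hm => hx (hsub _ hm), fun x hx => h.narr x fun hm => hx (hsub _ hm),
    fun x hx => h.rreg x fun hm => hx (hsub _ hm), fun x hx => h.rarr x fun hm => hx (hsub _ hm)⟩

theorem seq_left {P : Prog} (Q : Prog) {s s' : State} (h : SameOutside P s s') :
    SameOutside (.seq P Q) s s' :=
  h.mono fun _ => List.subset_append_left _ _

theorem seq_right (P : Prog) {Q : Prog} {s s' : State} (h : SameOutside Q s s') :
    SameOutside (.seq P Q) s s' :=
  h.mono fun _ => List.subset_append_right _ _

end SameOutside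

theorem Instr.sameOutside (c : Instr) (s : State) : SameOutside (.instr c) s (c.apply s) := by
  constructor <;> intro x hx <;>
    cases c <;> simp_all [Prog.collect, Instr.nregs, Instr.narrs, Instr.rregs, Instr.rarrs,
      Instr.apply]

/-- The frame rule. It reduces the claim that a register or array is untouched to non-membership in
an explicit list, which is usually decidable by computation. -/
theorem Exec.sameOutside {P : Prog} {s s' : State} {k : ℕ} (h : Exec P s k s') :
    SameOutside P s s' := by
  induction h with
  | skip s => exact .refl _ _
  | instr c s => exact c.sameOutside s
  | seq _ _ ih ih' => exact (ih.seq_left _).trans (ih'.seq_right _)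
  | condTrue _ _ ih => exact ih.mono fun _ => List.subset_append_left _ _
  | condFalse _ _ ih => exact ih.mono fun _ => List.subset_append_right _ _
  | loopDone _ => exact .refl _ _
  | loopMore _ _ _ ih ih' => exact SameOutside.trans (ih.mono fun _ => List.Subset.refl _) ih'

/-- Started in `s`, the program `P` halts after at most `c` steps in a state that satisfies `Q`. -/
def Within (P : Prog) (s : State) (c : ℕ) (Q : State → Prop) : Prop :=
  ∃ k s', Exec P s k s' ∧ k ≤ c ∧ Q s'

namespace Within

theorem mono {P : Prog} {s : State} {c c' : ℕ} {Q R : State → Prop} (h : Within P s c Q)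
    (hc : c ≤ c') (hQ : ∀ s', SameOutside P s s' → Q s' → R s') : Within P s c' R := by
  obtain ⟨k, s', he, hk, hq⟩ := h
  exact ⟨k, s', he, hk.trans hc, hQ s' he.sameOutside hq⟩

/-- The continuation also receives the frame condition, so the intermediate assertion Q only needs
to record what P changes. -/
theorem seq {P P' : Prog} {s : State} {c c' : ℕ} {Q R : State → Prop} (h : Within P s c Q)
    (h' : ∀ s', SameOutside P s s' → Q s' → Within P' s' c' R) :
    Within (.seq P P') s (c + c') R := by
  obtain ⟨k, s', he, hk, hq⟩ := h
  obtain ⟨k', s'', he', hk', hr⟩ := h' s' he.sameOutside hq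
  exact ⟨_, s'', .seq he he', Nat.add_le_add hk hk', hr⟩

theorem skip {s : State} {Q : State → Prop} {c : ℕ} (h : Q s) : Within .skip s c Q :=
  ⟨0, s, .skip s, Nat.zero_le c, h⟩

theorem instr {c : Instr} {s : State} {Q : State → Prop} (h : Q (c.apply s)) :
    Within (.instr c) s 1 Q :=
  ⟨1, _, .instr c s, le_rfl, h⟩

theorem cond {b : Test} {P P' : Prog} {s : State} {c : ℕ} {Q : State → Prop}
    (h : b.Holds s → Within P s c Q) (h' : ¬ b.Holds s → Within P' s c Q) :
    Within (.cond b P P') s (1 + c) Q := by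
  by_cases hb : b.Holds s
  · obtain ⟨k, s', he, hk, hq⟩ := h hb
    exact ⟨_, s', .condTrue hb he, by omega, hq⟩
  · obtain ⟨k, s', he, hk, hq⟩ := h' hb
    exact ⟨_, s', .condFalse hb he, by omega, hq⟩

end Within

/-- Straight-line code. -/
def block : List Instr → Prog
  | [] => .skip
  | c :: l => .seq (.instr c) (block l)

theorem Within.block {l : List Instr} {s : State} {Q : State → Prop} {c : ℕ}
    (hc : l.length = c) (h : Q (l.foldl (fun s c => c.apply s) s)) : Within (block l) s c Q := by
  induction l generalizing s c with
  | nil => exact .skip h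
  | cons i l ih =>
    rw [← hc, List.length_cons, add_comm]
    exact .seq (Q := fun s' => s' = i.apply s) (.instr rfl) fun s' _ hs' => ih rfl (hs' ▸ h)

/-- `for i < lim do P`; the natural register `2` holds the constant one. -/
def forLoop (i lim : ℕ) (P : Prog) : Prog :=
  .seq (.instr (.nconst i 0)) (.loop (.nlt i lim) (.seq P (.instr (.nadd i i 2))))

/-- `s` with the natural register `i` set to `v`. -/
def State.setN (s : State) (i v : ℕ) : State := { s with nreg := Function.update s.nreg i v }

@[simp] theorem State.setN_nreg (s : State) (i v x : ℕ) :
    (s.setN i v).nreg x = if x = i then v else s.nreg x := by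
  simp [State.setN, Function.update_apply]

@[simp] theorem State.setN_narr (s : State) (i v : ℕ) : (s.setN i v).narr = s.narr := rfl

@[simp] theorem State.setN_rreg (s : State) (i v : ℕ) : (s.setN i v).rreg = s.rreg := rfl

@[simp] theorem State.setN_rarr (s : State) (i v : ℕ) : (s.setN i v).rarr = s.rarr := rfl

theorem SameOutside.setN {P : Prog} {s s' : State} (h : SameOutside P s s') {i : ℕ} (v : ℕ)
    (hi : i ∈ P.collect Instr.nregs) : SameOutside P s (s'.setN i v) := by
  refine ⟨fun x hx => ?_, h.narr, h.rreg, h.rarr⟩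
  have : x ≠ i := fun he => hx (he ▸ hi)
  simpa [this] using h.nreg x hx

/-- The rule for counting loops: `Inv t` holds before the iteration with counter `t`. -/
theorem Within.forLoop {i lim N c : ℕ} {P : Prog} {s : State} {Q : State → Prop}
    (Inv : ℕ → State → Prop) (hlim : s.nreg lim = N) (hone : s.nreg 2 = 1)
    (hwr : ∀ x ∈ [2, i, lim], x ∉ P.collect Instr.nregs) (hne : i ≠ lim ∧ i ≠ 2)
    (h0 : Inv 0 (s.setN i 0))
    (step : ∀ t s', t < N → SameOutside (forLoop i lim P) s s' → s'.nreg i = t → Inv t s' →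
      Within P s' c (fun s'' => Inv (t + 1) (s''.setN i (t + 1))))
    (post : ∀ s', SameOutside (forLoop i lim P) s s' → Inv N s' → Q s') :
    Within (forLoop i lim P) s (2 + N * (c + 2)) Q := by
  have hmem : i ∈ (RobustSubspace.forLoop i lim P).collect Instr.nregs := by
    simp [RobustSubspace.forLoop, Prog.collect, Instr.nregs]
  have hlim' : lim ∉ (RobustSubspace.forLoop i lim P).collect Instr.nregs := by
    simpa [RobustSubspace.forLoop, Prog.collect, Instr.nregs, Ne.symm hne.1]
      using hwr lim (by simp)
  have hone' : 2 ∉ (RobustSubspace.forLoop i lim P).collect Instr.nregs := by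
    simpa [RobustSubspace.forLoop, Prog.collect, Instr.nregs, Ne.symm hne.2]
      using hwr 2 (by simp)
  -- Induction on the number r of iterations left. Each costs at most c + 2 (test, body, increment)
  -- and the final failing test costs one; the other constant step of the bound initializes the
  -- counter.
  have main : ∀ r t s', t + r = N → SameOutside (RobustSubspace.forLoop i lim P) s s' →
      s'.nreg i = t → Inv t s' →
      Within (.loop (.nlt i lim) (.seq P (.instr (.nadd i i 2)))) s' (1 + r * (c + 2)) Q := by
    intro r
    induction r with
    | zero =>
      intro t s' ht hs' hi hinv
      refine ⟨1, s', .loopDone ?_, by omega, post s' hs' ?_⟩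
      · rw [Test.Holds, hs'.nreg lim hlim', hi, hlim]
        omega
      · rwa [show N = t by omega]
    | succ r ih =>
      intro t s' ht hs' hi hinv
      obtain ⟨k, s'', he, hk, hq⟩ := step t s' (by omega) hs' hi hinv
      have hf := he.sameOutside
      have happ : (Instr.nadd i i 2).apply s'' = s''.setN i (t + 1) := by
        simp only [Instr.apply, State.setN]
        rw [hf.nreg i (hwr i (by simp)), hf.nreg 2 (hwr 2 (by simp)), hi, hs'.nreg 2 hone', hone]
      have hs'' : SameOutside (RobustSubspace.forLoop i lim P) s (s''.setN i (t + 1)) := by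
        refine (hs'.trans ?_).setN _ hmem
        exact ((hf.seq_left _).mono fun _ => List.Subset.refl _ :
          SameOutside (.loop (.nlt i lim) (.seq P (.instr (.nadd i i 2)))) s' s'').seq_right _
      obtain ⟨k', s₃, he', hk', hq'⟩ := ih (t + 1) (s''.setN i (t + 1)) (by omega) hs''
        (by simp) hq
      refine ⟨1 + (k + 1) + k', s₃, .loopMore ?_ (.seq he (happ ▸ .instr _ _)) he', ?_, hq'⟩
      · rw [Test.Holds, hs'.nreg lim hlim', hi, hlim]
        omega
      · have : (r + 1) * (c + 2) = r * (c + 2) + (c + 2) := by ring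
        omega
  have h1 := main N 0 (s.setN i 0) (by omega) ((SameOutside.refl _ s).setN 0 hmem) (by simp) h0
  obtain ⟨k, s', he, hk, hq⟩ := h1
  exact ⟨1 + k, s', .seq (.instr _ _) he, by omega, hq⟩

/-! ### Gram-Schmidt orthogonalization with coefficients -/

section GramSchmidt

variable {n m : ℕ}

/-- The first `n` entries of a row. -/
def residue (n : ℕ) (g : ℕ → ℝ) : Fin n → ℝ := fun x => g x

/-- The last `m` entries of a row of length `n + m`. -/
def coeff (n m : ℕ) (g : ℕ → ℝ) : Fin m → ℝ := fun i => g (n + i)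

/-- One reduction step of a row `g` against the row `h`. -/
noncomputable def reduceStep (n : ℕ) (h g : ℕ → ℝ) : ℕ → ℝ := fun x =>
  g x - residue n g ⬝ᵥ residue n h / residue n h ⬝ᵥ residue n h * h x

theorem residue_reduceStep (h g : ℕ → ℝ) : residue n (reduceStep n h g) =
    residue n g - (residue n g ⬝ᵥ residue n h / residue n h ⬝ᵥ residue n h) • residue n h := rfl

theorem coeff_reduceStep (h g : ℕ → ℝ) : coeff n m (reduceStep n h g) =
    coeff n m g - (residue n g ⬝ᵥ residue n h / residue n h ⬝ᵥ residue n h) • coeff n m h := rfl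

/-- The row `g` is a combination of the column `q t` (with coefficient one) and of the columns
`q 0, ..., q (l - 1)`, together with its coefficients. -/
structure RowOf (A : Matrix (Fin n) (Fin m) ℝ) (q : ℕ → Fin m) (l t : ℕ) (g : ℕ → ℝ) :
    Prop where
  aug : A.mulVec (coeff n m g) = residue n g
  lead : coeff n m g (q t) = 1
  supp : ∀ i, coeff n m g i ≠ 0 → i = q t ∨ ∃ j < l, i = q j

theorem RowOf.mono {A : Matrix (Fin n) (Fin m) ℝ} {q : ℕ → Fin m} {l l' t : ℕ} {g : ℕ → ℝ}
    (h : RowOf A q l t g) (hl : l ≤ l') : RowOf A q l' t g :=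
  ⟨h.aug, h.lead, fun i hi => (h.supp i hi).imp_right fun ⟨j, hj, he⟩ => ⟨j, hj.trans_le hl, he⟩⟩

theorem rowOf_unit {A : Matrix (Fin n) (Fin m) ℝ} {q : ℕ → Fin m} {t : ℕ} {g : ℕ → ℝ}
    (hres : residue n g = A.col (q t)) (hco : coeff n m g = Pi.single (q t) 1) :
    RowOf A q 0 t g := by
  refine ⟨?_, ?_, fun i hi => ?_⟩
  · rw [hres, hco]; simp
  · rw [hco]; simp
  · rw [hco] at hi
    by_contra hne
    push Not at hne
    exact hi (Pi.single_eq_of_ne hne.1 _)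

/-- The state of the orthogonalization of the columns `q 0, q 1, ...` after `t` columns: the first
`K` rows are nonzero and orthogonal, and all other rows are orthogonal to them. -/
structure GramSchmidt (A : Matrix (Fin n) (Fin m) ℝ) (q : ℕ → Fin m) (t K : ℕ)
    (B : ℕ → ℕ → ℝ) : Prop where
  le : K ≤ t
  row : ∀ j < t, RowOf A q (min j K) j (B j)
  ne : ∀ j < K, residue n (B j) ≠ 0
  orth : ∀ j < t, ∀ l < K, l < j → residue n (B l) ⬝ᵥ residue n (B j) = 0
  residue_eq_zero : K < t → residue n (B K) = 0

theorem GramSchmidt.zero (A : Matrix (Fin n) (Fin m) ℝ) (q : ℕ → Fin m) (B : ℕ → ℕ → ℝ) :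
    GramSchmidt A q 0 0 B :=
  ⟨le_rfl, by simp, by simp, by simp, by simp⟩

theorem GramSchmidt.congr {A : Matrix (Fin n) (Fin m) ℝ} {q : ℕ → Fin m} {t K : ℕ}
    {B B' : ℕ → ℕ → ℝ} (h : GramSchmidt A q t K B) (hB : ∀ j < t, B' j = B j) :
    GramSchmidt A q t K B' where
  le := h.le
  row j hj := hB j hj ▸ h.row j hj
  ne j hj := hB j (hj.trans_le h.le) ▸ h.ne j hj
  orth j hj l hl hlj := by
    rw [hB j hj, hB l (hl.trans_le h.le)]; exact h.orth j hj l hl hlj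
  residue_eq_zero hK := by rw [hB K hK]; exact h.residue_eq_zero hK

theorem dotProduct_self_ne_zero {v : Fin n → ℝ} (hv : v ≠ 0) : v ⬝ᵥ v ≠ 0 :=
  fun h => hv (dotProduct_self_eq_zero.1 h)

/-- A partially reduced row: it belongs to position `t` and is orthogonal to the first `l`
rows. -/
structure PartlyReduced (A : Matrix (Fin n) (Fin m) ℝ) (q : ℕ → Fin m) (B : ℕ → ℕ → ℝ)
    (t l : ℕ) (g : ℕ → ℝ) : Prop where
  row : RowOf A q l t g
  orth : ∀ j < l, residue n (B j) ⬝ᵥ residue n g = 0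

/-- Subtracting the projection makes the row orthogonal to row l and keeps it orthogonal to the
earlier ones, since row l is orthogonal to them. The coefficients undergo the same operation, so
they keep describing the residue. -/
theorem PartlyReduced.step {A : Matrix (Fin n) (Fin m) ℝ} {q : ℕ → Fin m} {B : ℕ → ℕ → ℝ}
    {t l K : ℕ} {g : ℕ → ℝ} (hB : GramSchmidt A q t K B) (hq : Set.InjOn q (Set.Iic t))
    (hl : l < K) (h : PartlyReduced A q B t l g) :
    PartlyReduced A q B t (l + 1) (reduceStep n (B l) g) := by
  have hlt : l < t := hl.trans_le hB.le
  have hrow := hB.row l hlt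
  have hmin : min l K = l := min_eq_left hl.le
  rw [hmin] at hrow
  refine ⟨⟨?_, ?_, fun i hi => ?_⟩, fun j hj => ?_⟩
  · rw [coeff_reduceStep, residue_reduceStep, Matrix.mulVec_sub, Matrix.mulVec_smul,
      h.row.aug, hrow.aug]
  -- Row l involves only `q 0, ..., q l`, and q is injective, so the leading coefficient at `q t`
  -- stays one.
  · have h0 : coeff n m (B l) (q t) = 0 := by
      by_contra hne
      rcases hrow.supp _ hne with he | ⟨j, hj, he⟩
      · exact hlt.ne' (hq (by simp) (by simp [hlt.le]) he)
      · exact (hj.trans hlt).ne' (hq (by simp) (by simp [(hj.trans hlt).le]) he)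
    rw [coeff_reduceStep, Pi.sub_apply, Pi.smul_apply, h0, h.row.lead]
    simp
  · by_cases hg : coeff n m g i = 0
    · have hb : coeff n m (B l) i ≠ 0 := by
        intro hb
        apply hi
        rw [coeff_reduceStep, Pi.sub_apply, Pi.smul_apply, hb, hg]
        simp
      rcases hrow.supp i hb with he | ⟨j, hj, he⟩
      · exact Or.inr ⟨l, Nat.lt_succ_self l, he⟩
      · exact Or.inr ⟨j, hj.trans (Nat.lt_succ_self l), he⟩
    · exact (h.row.mono (Nat.le_succ l)).supp i hg
  · rw [residue_reduceStep, dotProduct_sub, dotProduct_smul, smul_eq_mul]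
    rcases Nat.lt_succ_iff_lt_or_eq.1 hj with hjl | rfl
    · rw [h.orth j hjl, hB.orth l hlt j (hjl.trans hl) hjl]
      simp
    · rw [div_mul_cancel₀ _ (dotProduct_self_ne_zero (hB.ne j hl)), dotProduct_comm, sub_self]

/-- K grows only while every column so far was independent of its predecessors (K = t). At the first
zero residue it freezes; later columns are reduced against these K rows only, even if their own
residue is nonzero. -/
theorem GramSchmidt.step {A : Matrix (Fin n) (Fin m) ℝ} {q : ℕ → Fin m} {B B' : ℕ → ℕ → ℝ}
    {t K K' : ℕ} (hB : GramSchmidt A q t K B) (hB' : ∀ j < t, B' j = B j)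
    (h : PartlyReduced A q B t K (B' t))
    (hK : K' = if K = t ∧ residue n (B' t) ≠ 0 then K + 1 else K) :
    GramSchmidt A q (t + 1) K' B' := by
  have hG := hB.congr hB'
  have horth : ∀ j < K, residue n (B' j) ⬝ᵥ residue n (B' t) = 0 := fun j hj => by
    rw [hB' j (hj.trans_le hB.le)]; exact h.orth j hj
  by_cases hc : K = t ∧ residue n (B' t) ≠ 0
  · rw [if_pos hc] at hK
    obtain ⟨rfl, hne⟩ := hc
    subst hK
    refine ⟨le_rfl, fun j hj => ?_, fun j hj => ?_, fun j hj l hl hlj => ?_, fun hlt => ?_⟩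
    · rcases Nat.lt_succ_iff_lt_or_eq.1 hj with hj | rfl
      · exact (hG.row j hj).mono (by omega)
      · exact h.row.mono (by omega)
    · rcases Nat.lt_succ_iff_lt_or_eq.1 hj with hj | rfl
      · exact hG.ne j hj
      · exact hne
    · rcases Nat.lt_succ_iff_lt_or_eq.1 hj with hj | rfl
      · exact hG.orth j hj l (hlj.trans hj) hlj
      · exact horth l hlj
    · omega
  · rw [if_neg hc] at hK
    subst hK
    refine ⟨hB.le.trans (Nat.le_succ t), fun j hj => ?_, hG.ne, fun j hj l hl hlj => ?_,
      fun hlt => ?_⟩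
    · rcases Nat.lt_succ_iff_lt_or_eq.1 hj with hj | rfl
      · exact hG.row j hj
      · exact h.row.mono (le_min hB.le le_rfl)
    · rcases Nat.lt_succ_iff_lt_or_eq.1 hj with hj | rfl
      · exact hG.orth j hj l hl hlj
      · exact horth l hl
    · rcases Nat.lt_succ_iff_lt_or_eq.1 hlt with hlt | rfl
      · exact hG.residue_eq_zero hlt
      · by_contra hne
        exact hc ⟨rfl, hne⟩

/-- Columns with nonzero orthogonal rows are linearly independent. -/
theorem GramSchmidt.linearIndependent {A : Matrix (Fin n) (Fin m) ℝ} {q : ℕ → Fin m} {t K : ℕ}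
    {B : ℕ → ℕ → ℝ} (h : GramSchmidt A q t K B) {J : Finset ℕ}
    (hJ : ∀ j ∈ J, j < K ∨ j < t ∧ residue n (B j) ≠ 0)
    (hJ' : ∀ i ∈ J, ∀ j ∈ J, K ≤ i → K ≤ j → i = j) (hK : Finset.range K ⊆ J) :
    LinearIndependent ℝ (fun i : J.image q => A.col i) := by
  have hne : ∀ j ∈ J, residue n (B j) ≠ 0 := fun j hj => (hJ j hj).elim (h.ne j) And.right
  have hlt : ∀ j ∈ J, j < t := fun j hj => (hJ j hj).elim (fun hj => hj.trans_le h.le) And.left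
  -- Two rows from position K on need not be orthogonal to each other; `hJ'` allows at most one such
  -- index in J.
  have horth : ∀ i ∈ J, ∀ j ∈ J, i ≠ j → residue n (B i) ⬝ᵥ residue n (B j) = 0 := by
    intro i hi j hj hij
    have hcase := hJ' i hi j hj
    rcases lt_or_gt_of_ne hij with hlt' | hlt'
    · exact h.orth j (hlt j hj) i (by omega) hlt'
    · rw [dotProduct_comm]
      exact h.orth i (hlt i hi) j (by omega) hlt'
  have hind : LinearIndependent ℝ (fun j : J => residue n (B j)) := by
    rw [Fintype.linearIndependent_iff]
    intro c hc j
    have h1 := congrArg (fun v => residue n (B j) ⬝ᵥ v) hc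
    simp only [dotProduct_sum, dotProduct_smul, dotProduct_zero] at h1
    rw [Finset.sum_eq_single j] at h1
    · exact (smul_eq_zero.1 h1).resolve_right (dotProduct_self_ne_zero (hne j j.2))
    · intro i _ hij
      rw [horth j j.2 i i.2 fun he => hij (Subtype.ext he.symm), smul_zero]
    · simp
  -- Every row is a combination of columns indexed by J, because J contains the whole prefix. So |J|
  -- independent rows force the columns to span at least |J| dimensions.
  have hsub : Submodule.span ℝ (Set.range fun j : J => residue n (B j)) ≤
      Submodule.span ℝ (Set.range fun i : J.image q => A.col i) := by
    rw [Submodule.span_le]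
    rintro _ ⟨j, rfl⟩
    have hrow := h.row j (hlt j j.2)
    simp only [SetLike.mem_coe]
    rw [← hrow.aug, mulVec_eq_sum_cols]
    refine Submodule.sum_mem _ fun i _ => ?_
    by_cases hi : coeff n m (B j) i = 0
    · simp [hi]
    · have himg : i ∈ J.image q := by
        rcases hrow.supp i hi with he | ⟨l, hl, he⟩
        · exact he ▸ Finset.mem_image_of_mem q j.2
        · exact he ▸ Finset.mem_image_of_mem q
            (hK (Finset.mem_range.2 (hl.trans_le (min_le_right _ _))))
      exact Submodule.smul_mem _ _ (Submodule.subset_span ⟨⟨i, himg⟩, rfl⟩)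
  rw [linearIndependent_iff_card_le_finrank_span, Set.finrank]
  calc Fintype.card (J.image q) ≤ J.card := by
        rw [Fintype.card_coe]; exact Finset.card_image_le
    _ = Module.finrank ℝ (Submodule.span ℝ (Set.range fun j : J => residue n (B j))) := by
      rw [finrank_span_eq_card hind]; simp
    _ ≤ _ := Submodule.finrank_mono hsub

/-- Rows with residue zero give kernel vectors. -/
theorem GramSchmidt.isKernelVector {A : Matrix (Fin n) (Fin m) ℝ} {q : ℕ → Fin m} {t K j : ℕ}
    {B : ℕ → ℕ → ℝ} (h : GramSchmidt A q t K B) (hj : j < t) (h0 : residue n (B j) = 0) :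
    IsKernelVector A (insert (q j) ((Finset.range K).image q)) (coeff n m (B j)) := by
  have hrow := h.row j hj
  refine ⟨fun hz => ?_, fun i hi => ?_, by rw [hrow.aug, h0]⟩
  · have := hrow.lead
    rw [hz] at this
    simp at this
  · by_contra hne
    apply hi
    rcases hrow.supp i hne with he | ⟨l, hl, he⟩
    · exact he ▸ Finset.mem_insert_self _ _
    · exact he ▸ Finset.mem_insert_of_mem (Finset.mem_image_of_mem q
        (Finset.mem_range.2 (hl.trans_le (min_le_right _ _))))

end GramSchmidt

/-! ### Recovering the inliers from the orthogonalized rows. -/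

namespace InlierModel

variable {n m d : ℕ} {A : Matrix (Fin n) (Fin m) ℝ} {T : Submodule ℝ (Fin n → ℝ)}

/-- Some window of `n` cyclically consecutive columns contains more than `d` inliers. -/
theorem exists_window (h : InlierModel A T d) [NeZero m] :
    ∃ s < m, d < (((Finset.range n).image fun j => Fin.ofNat m (s + j)) ∩ inliers A T).card := by
  by_contra! hall
  have hcard : ∀ s < m, ∑ j ∈ Finset.range n,
      (if Fin.ofNat m (s + j) ∈ inliers A T then 1 else 0) ≤ d := by
    intro s hs
    refine le_trans ?_ (hall s hs)
    rw [← Finset.card_filter, ← Finset.filter_mem_eq_inter, Finset.filter_image,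
      Finset.card_image_of_injOn]
    intro i hi j hj hij
    have hi' : i < m := (Finset.mem_range.1 (Finset.mem_filter.1 hi).1).trans_le h.le
    have hj' : j < m := (Finset.mem_range.1 (Finset.mem_filter.1 hj).1).trans_le h.le
    have hmod : (s + i) ≡ (s + j) [MOD m] := by simpa [Fin.ext_iff, Nat.ModEq] using hij
    exact (Nat.ModEq.add_left_cancel' s hmod).eq_of_lt_of_lt hi' hj'
  -- Double counting: every inlier lies in exactly n of the m windows. If each window had at most d
  -- inliers, then n|L| ≤ d m.
  have hsum : ∑ s ∈ Finset.range m, ∑ j ∈ Finset.range n,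
      (if Fin.ofNat m (s + j) ∈ inliers A T then 1 else 0) = n * (inliers A T).card := by
    rw [Finset.sum_comm]
    have : ∀ j ∈ Finset.range n, ∑ s ∈ Finset.range m,
        (if Fin.ofNat m (s + j) ∈ inliers A T then 1 else 0) = (inliers A T).card := by
      intro j _
      rw [← Fin.sum_univ_eq_sum_range
        (fun s => if Fin.ofNat m (s + j) ∈ inliers A T then 1 else 0)]
      have h1 : ∀ s : Fin m, Fin.ofNat m (s + j) = Equiv.addRight (Fin.ofNat m j) s := by
        intro s
        simp [Fin.ext_iff, Fin.val_add]
      simp only [h1]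
      rw [Equiv.sum_comp (Equiv.addRight (Fin.ofNat m j))
        (fun i => if i ∈ inliers A T then 1 else 0)]
      simp
    rw [Finset.sum_congr rfl this]
    simp
  have hle := Finset.sum_le_sum fun s hs => hcard s (Finset.mem_range.1 hs)
  rw [hsum] at hle
  have := h.many
  simp only [Finset.sum_const, Finset.card_range, smul_eq_mul] at hle
  rw [mul_comm m] at hle
  omega

variable {q : ℕ → Fin m} {K t : ℕ} {B : ℕ → ℕ → ℝ}

theorem card_prefix_inter_le (h : InlierModel A T d) (hG : GramSchmidt A q t K B) (hK : K ≤ n) :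
    (((Finset.range K).image q) ∩ inliers A T).card ≤ d := by
  rw [← h.linearIndependent_iff (Finset.card_image_le.trans (by simpa using hK))]
  exact hG.linearIndependent (by simp_all) (fun i hi _ _ hKi => by simp at hi; omega)
    (Finset.Subset.refl _)

/-- If the first `n` columns are dependent then the orthogonalization stops among them. -/
theorem lt_of_window (h : InlierModel A T d) (hG : GramSchmidt A q t K B)
    (hd : d < (((Finset.range n).image q) ∩ inliers A T).card) : K < n := by
  by_contra! hK
  have hind := hG.linearIndependent (J := Finset.range K) (by simp_all)
    (fun i hi _ _ hKi => by simp at hi; omega) (Finset.Subset.refl _)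
  have hsub : (Finset.range n).image q ⊆ (Finset.range K).image q :=
    Finset.image_subset_image (Finset.range_subset_range.2 hK)
  have hind' : LinearIndependent ℝ (fun i : (Finset.range n).image q => A.col i) :=
    hind.comp (fun i : (Finset.range n).image q =>
      (⟨i, hsub i.2⟩ : (Finset.range K).image q))
      (fun a b hab => Subtype.ext (congrArg (fun z : (Finset.range K).image q => (z : Fin m)) hab))
  rw [h.linearIndependent_iff (Finset.card_image_le.trans (by simp))] at hind'
  omega

theorem card_insert_prefix_le (hK : K < n) (j : ℕ) :
    (insert (q j) ((Finset.range K).image q)).card ≤ n :=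
  (Finset.card_insert_le _ _).trans
    (Nat.succ_le_of_lt (Finset.card_image_le.trans_lt (by simpa using hK)))

/-- The first `K` columns contain exactly `d` inliers. -/
theorem card_prefix_inter (h : InlierModel A T d) (hG : GramSchmidt A q t K B) (hK : K < n)
    (hKt : K < t) : (((Finset.range K).image q) ∩ inliers A T).card = d := by
  classical
  refine le_antisymm (h.card_prefix_inter_le hG hK.le) ?_
  have hker := hG.isKernelVector hKt (hG.residue_eq_zero hKt)
  obtain ⟨h1, h2⟩ := h.support_of_kernel (card_insert_prefix_le hK K) hker
  -- The support has more than d elements, all inliers; at most one of them is `q K`, so at least d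
  -- lie in the prefix.
  have h3 : (Finset.univ.filter fun i => coeff n m (B K) i ≠ 0) ⊆
      insert (q K) (((Finset.range K).image q) ∩ inliers A T) := by
    intro i hi
    have hiL := h1 hi
    simp only [Finset.mem_filter, Finset.mem_univ, true_and] at hi
    by_contra hn
    apply hi
    refine hker.2.1 i fun hm => hn ?_
    rcases Finset.mem_insert.1 hm with hm | hm
    · exact Finset.mem_insert.2 (Or.inl hm)
    · exact Finset.mem_insert_of_mem (Finset.mem_inter.2 ⟨hm, hiL⟩)
  have h4 := Finset.card_le_card h3
  have h5 := Finset.card_insert_le (q K) (((Finset.range K).image q) ∩ inliers A T)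
  omega

/-- The inliers are the columns that occur in the kernel vectors of the rows with residue zero. -/
theorem mem_inliers_iff (h : InlierModel A T d) (hG : GramSchmidt A q t K B)
    (hq : Set.InjOn q (Set.Iio t)) (hsurj : ∀ i, ∃ j < t, q j = i) (hK : K < n) (hKt : K < t)
    (i : Fin m) :
    i ∈ inliers A T ↔ ∃ j < t, residue n (B j) = 0 ∧ coeff n m (B j) i ≠ 0 := by
  classical
  constructor
  · intro hi
    obtain ⟨j, hj, rfl⟩ := hsurj i
    have hd := h.card_prefix_inter hG hK hKt
    by_cases hjK : j < K
    -- An inlier of the prefix must occur in the kernel vector of row K: otherwise the support would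
    -- fit into `q K` and d - 1 prefix inliers, which is too few.
    · refine ⟨K, hKt, hG.residue_eq_zero hKt, ?_⟩
      by_contra hzero
      have hker := hG.isKernelVector hKt (hG.residue_eq_zero hKt)
      obtain ⟨h1, h2⟩ := h.support_of_kernel (card_insert_prefix_le hK K) hker
      have h3 : (Finset.univ.filter fun i => coeff n m (B K) i ≠ 0) ⊆
          insert (q K) ((((Finset.range K).image q) ∩ inliers A T).erase (q j)) := by
        intro i hi
        have hiL := h1 hi
        simp only [Finset.mem_filter, Finset.mem_univ, true_and] at hi
        have hij : i ≠ q j := fun he => hi (he ▸ hzero)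
        by_contra hn
        apply hi
        refine hker.2.1 i fun hm => hn ?_
        rcases Finset.mem_insert.1 hm with hm | hm
        · exact Finset.mem_insert.2 (Or.inl hm)
        · exact Finset.mem_insert_of_mem
            (Finset.mem_erase.2 ⟨hij, Finset.mem_inter.2 ⟨hm, hiL⟩⟩)
      have h4 := Finset.card_le_card h3
      have h5 := Finset.card_insert_le (q K)
        ((((Finset.range K).image q) ∩ inliers A T).erase (q j))
      have h6 : q j ∈ ((Finset.range K).image q) ∩ inliers A T :=
        Finset.mem_inter.2 ⟨Finset.mem_image_of_mem q (Finset.mem_range.2 hjK), hi⟩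
      have h7 := Finset.card_erase_add_one h6
      omega
    -- An inlier outside the prefix has residue zero: otherwise it would form with the prefix an
    -- independent set containing d + 1 inliers. Its own coefficient is one.
    · refine ⟨j, hj, ?_, by rw [(hG.row j hj).lead]; exact one_ne_zero⟩
      by_contra hne
      have hind := hG.linearIndependent (J := insert j (Finset.range K)) ?_ ?_
        (Finset.subset_insert _ _)
      · rw [Finset.image_insert, h.linearIndependent_iff (card_insert_prefix_le hK j),
          Finset.insert_inter_of_mem hi, Finset.card_insert_of_notMem, hd] at hind
        · omega
        · intro hm
          obtain ⟨l, hl, hle⟩ := Finset.mem_image.1 (Finset.mem_inter.1 hm).1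
          have hl' := Finset.mem_range.1 hl
          have := hq (Set.mem_Iio.2 (hl'.trans hKt)) (Set.mem_Iio.2 hj) hle
          omega
      · intro l hl
        rcases Finset.mem_insert.1 hl with rfl | hl
        · exact Or.inr ⟨hj, hne⟩
        · exact Or.inl (Finset.mem_range.1 hl)
      · intro a ha b hb hKa hKb
        simp only [Finset.mem_insert, Finset.mem_range] at ha hb
        omega
  · rintro ⟨j, hj, h0, hne⟩
    have hker := hG.isKernelVector hj h0
    obtain ⟨h1, -⟩ := h.support_of_kernel (card_insert_prefix_le hK j) hker
    exact h1 (by simpa using hne)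

end InlierModel

/-! ### The orthogonalization program -/

/-- The registers that hold the input and the constants one and `n + m`. -/
structure Env {n m : ℕ} (A : Matrix (Fin n) (Fin m) ℝ) (s : State) : Prop where
  rows : s.nreg 0 = n
  cols : s.nreg 1 = m
  one : s.nreg 2 = 1
  zero : s.nreg 3 = 0
  width : s.nreg 13 = n + m
  entry : ∀ (x : Fin n) (i : Fin m), s.rarr 0 x i = A x i

theorem Env.of_sameOutside {n m : ℕ} {A : Matrix (Fin n) (Fin m) ℝ} {s s' : State} {P : Prog}
    (h : Env A s) (hs : SameOutside P s s')
    (hn : ∀ x ∈ [0, 1, 2, 3, 13], x ∉ P.collect Instr.nregs)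
    (ha : 0 ∉ P.collect Instr.rarrs) : Env A s' where
  rows := (hs.nreg 0 (hn _ (by decide))).trans h.rows
  cols := (hs.nreg 1 (hn _ (by decide))).trans h.cols
  one := (hs.nreg 2 (hn _ (by decide))).trans h.one
  zero := (hs.nreg 3 (hn _ (by decide))).trans h.zero
  width := (hs.nreg 13 (hn _ (by decide))).trans h.width
  entry x i := by rw [hs.rarr 0 ha]; exact h.entry x i

/-- Sets the real register `r` to the inner product of the rows numbered by the registers `a` and
`b`. -/
def dotProg (a b r : ℕ) : Prog :=
  .seq (block [.rconst r 0])
    (forLoop 8 0 (block [.rload 3 2 a 8, .rload 4 2 b 8, .rmul 3 3 4, .radd r r 3]))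

/-- Costs are written over an arbitrary commutative semiring, so that the same expression gives the
step count at numbers and the bounding polynomial at variables. -/
def dotCost {R : Type*} [CommSemiring R] (n : R) : R := 1 + (2 + n * (4 + 2))

theorem residue_dotProduct_residue (n : ℕ) (g h : ℕ → ℝ) :
    residue n g ⬝ᵥ residue n h = ∑ x ∈ Finset.range n, g x * h x :=
  Fin.sum_univ_eq_sum_range (fun x => g x * h x) n

theorem within_dotProg {n m : ℕ} {A : Matrix (Fin n) (Fin m) ℝ} {s : State} (hs : Env A s)
    {a b r : ℕ} (ha : a ≠ 8) (hb : b ≠ 8) (hr3 : r ≠ 3) (hr4 : r ≠ 4) :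
    Within (dotProg a b r) s (dotCost n) fun s' => s'.rreg r =
      residue n (s.rarr 2 (s.nreg a)) ⬝ᵥ residue n (s.rarr 2 (s.nreg b)) := by
  refine .seq (Q := fun s' => s'.rreg r = 0) (.block rfl ?_) fun s₁ hf₁ h₁ => ?_
  · simp [Instr.apply]
  have e₁ := hs.of_sameOutside hf₁ (by simp [block, Prog.collect, Instr.nregs])
    (by simp [block, Prog.collect, Instr.rarrs])
  have harr : s₁.rarr = s.rarr := funext fun c =>
    hf₁.rarr c (by simp [block, Prog.collect, Instr.rarrs])
  have hnr : s₁.nreg = s.nreg := funext fun c =>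
    hf₁.nreg c (by simp [block, Prog.collect, Instr.nregs])
  refine .forLoop (fun k s' => s'.rreg r = ∑ x ∈ Finset.range k,
    s.rarr 2 (s.nreg a) x * s.rarr 2 (s.nreg b) x) e₁.rows e₁.one
    (by simp [block, Prog.collect, Instr.nregs]) (by decide) (by simpa using h₁) ?_ ?_
  · intro t s₂ ht hf₂ hc h₂
    refine .block rfl ?_
    have h2 : s₂.rarr 2 = s.rarr 2 := by
      rw [hf₂.rarr 2 (by simp [forLoop, block, Prog.collect, Instr.rarrs]), harr]
    have ha' : s₂.nreg a = s.nreg a := by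
      rw [hf₂.nreg a (by simp [forLoop, block, Prog.collect, Instr.nregs, ha]), hnr]
    have hb' : s₂.nreg b = s.nreg b := by
      rw [hf₂.nreg b (by simp [forLoop, block, Prog.collect, Instr.nregs, hb]), hnr]
    simp [Instr.apply, hr3, hr4, h2, ha', hb', hc, h₂,
      Finset.sum_range_succ]
  · intro s₂ _ h₂
    rw [h₂, residue_dotProduct_residue]

/-- Fills row `t` (register 7) with the column `q` (register 10) followed by the unit vector. -/
def loadRow : Prog :=
  .seq (forLoop 8 0 (block [.rload 0 0 8 10, .rstore 2 7 8 0])) <|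
  .seq (forLoop 8 1 (block [.nadd 12 0 8, .rconst 0 0, .rstore 2 7 12 0]))
    (block [.nadd 12 0 10, .rconst 0 1, .rstore 2 7 12 0])

def loadCost {R : Type*} [CommSemiring R] (n m : R) : R :=
  (2 + n * (2 + 2)) + ((2 + m * (3 + 2)) + 3)

theorem within_loadRow {n m : ℕ} {A : Matrix (Fin n) (Fin m) ℝ} {s : State} (hs : Env A s)
    {q : Fin m} (hq : s.nreg 10 = q) :
    Within loadRow s (loadCost n m) fun s' =>
      (∀ r, r ≠ s.nreg 7 → s'.rarr 2 r = s.rarr 2 r) ∧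
      residue n (s'.rarr 2 (s.nreg 7)) = A.col q ∧
      coeff n m (s'.rarr 2 (s.nreg 7)) = Pi.single q 1 := by
  refine .seq (Q := fun s' => (∀ r, r ≠ s.nreg 7 → s'.rarr 2 r = s.rarr 2 r) ∧
    ∀ x < n, s'.rarr 2 (s.nreg 7) x = s.rarr 0 x q) ?_ fun s₁ hf₁ h₁ => ?_
  · refine .forLoop (fun k s' => (∀ r, r ≠ s.nreg 7 → s'.rarr 2 r = s.rarr 2 r) ∧
      ∀ x < k, s'.rarr 2 (s.nreg 7) x = s.rarr 0 x q) hs.rows hs.one (by decide) (by decide)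
      (by simp) ?_ (fun s' _ h => h)
    intro t s₂ ht hf₂ hc ⟨h₂, h₂'⟩
    refine .block rfl ?_
    have h7 := hf₂.nreg 7 (by decide)
    have h10 := hf₂.nreg 10 (by decide)
    have h0 := hf₂.rarr 0 (by decide)
    refine ⟨fun r hr => ?_, fun x hx => ?_⟩
    · funext y
      simp [Instr.apply, h7, hr, h₂ r hr]
    · by_cases hxt : x = t
      · simp [Instr.apply, h7, h10, h0, hc, hxt, hq]
      · simp [Instr.apply, h7, hc, hxt, h₂' x (by omega)]
  have e₁ := hs.of_sameOutside hf₁ (by decide) (by decide)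
  have h7₁ := hf₁.nreg 7 (by decide)
  have h10₁ := hf₁.nreg 10 (by decide)
  refine .seq (Q := fun s' => (∀ r, r ≠ s.nreg 7 → s'.rarr 2 r = s.rarr 2 r) ∧
    (∀ x < n, s'.rarr 2 (s.nreg 7) x = s.rarr 0 x q) ∧
    ∀ x < m, s'.rarr 2 (s.nreg 7) (n + x) = 0) ?_ fun s₂ hf₂ h₂ => ?_
  · refine .forLoop (fun k s' => (∀ r, r ≠ s.nreg 7 → s'.rarr 2 r = s.rarr 2 r) ∧
      (∀ x < n, s'.rarr 2 (s.nreg 7) x = s.rarr 0 x q) ∧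
      ∀ x < k, s'.rarr 2 (s.nreg 7) (n + x) = 0) e₁.cols e₁.one (by decide) (by decide)
      (by simpa using h₁) ?_ (fun s' _ h => h)
    intro t s₂ ht hf₂ hc ⟨h₂, h₂', h₂''⟩
    refine .block rfl ?_
    have h7 := (hf₂.nreg 7 (by decide)).trans h7₁
    have h0 := (hf₂.nreg 0 (by decide)).trans e₁.rows
    refine ⟨fun r hr => ?_, fun x hx => ?_, fun x hx => ?_⟩
    · funext y
      simp [Instr.apply, h7, hr, h₂ r hr]
    · have hne : x ≠ n + t := by omega
      simp [Instr.apply, h7, hc, h0, hne, h₂' x hx]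
    · by_cases hxt : x = t
      · simp [Instr.apply, h7, h0, hc, hxt]
      · simp [Instr.apply, h7, h0, hc, hxt, h₂'' x (by omega)]
  have e₂ := e₁.of_sameOutside hf₂ (by decide) (by decide)
  have h7 := (hf₂.nreg 7 (by decide)).trans h7₁
  have h10 := (hf₂.nreg 10 (by decide)).trans h10₁
  obtain ⟨h₂, h₂', h₂''⟩ := h₂
  refine .block rfl ⟨fun r hr => ?_, ?_, ?_⟩
  · funext y
    simp [Instr.apply, h7, hr, h₂ r hr]
  · funext x
    have hne : (x : ℕ) ≠ n + q := by omega
    simp [Instr.apply, h7, h10, hq, e₂.rows, residue, hne,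
      h₂' x x.2, hs.entry, Matrix.col]
  · funext i
    by_cases hi : i = q
    · simp [Instr.apply, h7, h10, hq, e₂.rows, coeff, hi]
    · have hi' : (i : ℕ) ≠ q := fun he => hi (Fin.ext he)
      simp [Instr.apply, h7, h10, hq, e₂.rows, coeff, hi, hi',
        h₂'' i i.2]

/-- Reduces row `t` (register 7) against row `j` (register 9). -/
def reduceProg : Prog :=
  .seq (dotProg 7 9 1) <| .seq (dotProg 9 9 2) <| .seq (block [.rdiv 1 1 2])
    (forLoop 8 13 (block [.rload 3 2 7 8, .rload 4 2 9 8, .rmul 4 1 4, .rsub 3 3 4,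
      .rstore 2 7 8 3]))

def reduceCost {R : Type*} [CommSemiring R] (n m : R) : R :=
  dotCost n + (dotCost n + (1 + (2 + (n + m) * (5 + 2))))

theorem within_reduceProg {n m : ℕ} {A : Matrix (Fin n) (Fin m) ℝ} {s : State} (hs : Env A s)
    (hne : s.nreg 9 ≠ s.nreg 7) :
    Within reduceProg s (reduceCost n m) fun s' =>
      (∀ r, r ≠ s.nreg 7 → s'.rarr 2 r = s.rarr 2 r) ∧
      ∀ x < n + m, s'.rarr 2 (s.nreg 7) x =
        reduceStep n (s.rarr 2 (s.nreg 9)) (s.rarr 2 (s.nreg 7)) x := by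
  refine .seq (within_dotProg hs (by decide) (by decide) (by decide) (by decide))
    fun s₁ hf₁ h₁ => ?_
  have e₁ := hs.of_sameOutside hf₁ (by decide) (by decide)
  refine .seq (within_dotProg e₁ (by decide) (by decide) (by decide) (by decide))
    fun s₂ hf₂ h₂ => ?_
  have e₂ := e₁.of_sameOutside hf₂ (by decide) (by decide)
  rw [hf₁.rarr 2 (by decide), hf₁.nreg 9 (by decide)] at h₂
  rw [← hf₂.rreg 1 (by decide)] at h₁
  set g := s.rarr 2 (s.nreg 7) with hg
  set h := s.rarr 2 (s.nreg 9) with hh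
  refine .seq (Q := fun s' => s'.rreg 1 =
    residue n g ⬝ᵥ residue n h / residue n h ⬝ᵥ residue n h) (.block rfl ?_)
    fun s₃ hf₃ h₃ => ?_
  · simp [Instr.apply, h₁, h₂]
  have e₃ := e₂.of_sameOutside hf₃ (by decide) (by decide)
  have harr : s₃.rarr 2 = s.rarr 2 := by
    rw [hf₃.rarr 2 (by decide), hf₂.rarr 2 (by decide), hf₁.rarr 2 (by decide)]
  have h7 : s₃.nreg 7 = s.nreg 7 := by
    rw [hf₃.nreg 7 (by decide), hf₂.nreg 7 (by decide), hf₁.nreg 7 (by decide)]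
  have h9 : s₃.nreg 9 = s.nreg 9 := by
    rw [hf₃.nreg 9 (by decide), hf₂.nreg 9 (by decide), hf₁.nreg 9 (by decide)]
  -- The row is overwritten in place with a factor computed beforehand, so the invariant must also
  -- record that the entries from k on are still the old ones.
  refine .forLoop (fun k s' => (∀ r, r ≠ s.nreg 7 → s'.rarr 2 r = s.rarr 2 r) ∧
      (∀ x < k, s'.rarr 2 (s.nreg 7) x = reduceStep n h g x) ∧
      ∀ x, k ≤ x → s'.rarr 2 (s.nreg 7) x = g x) e₃.width e₃.one (by decide) (by decide)
      (by simp [harr, hg]) ?_ (fun s' _ h => ⟨h.1, h.2.1⟩)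
  intro t s₄ ht hf₄ hc ⟨h₄, h₄', h₄''⟩
  refine .block rfl ?_
  have h7' := (hf₄.nreg 7 (by decide)).trans h7
  have h9' := (hf₄.nreg 9 (by decide)).trans h9
  have hr1 := (hf₄.rreg 1 (by decide)).trans h₃
  have hrow : s₄.rarr 2 (s.nreg 9) = h := by rw [h₄ _ hne, hh]
  refine ⟨fun r hr => ?_, fun x hx => ?_, fun x hx => ?_⟩
  · funext y
    simp [Instr.apply, h7', hr, h₄ r hr]
  · by_cases hxt : x = t
    · simp [Instr.apply, h7', h9', hc, hxt, hr1, hrow, h₄'' t le_rfl,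
        reduceStep]
    · simp [Instr.apply, h7', hc, hxt, h₄' x (by omega)]
  · have hxt : x ≠ t := by omega
    simp [Instr.apply, h7', hc, hxt, h₄'' x (by omega)]

/-- Computes row `t` (register 7) of the orthogonalization and updates the number `K` (register 4)
of orthogonal rows. -/
def rowProg : Prog :=
  .seq (block [.nadd 11 5 7, .nload 10 2 11]) <| .seq loadRow <| .seq (forLoop 9 4 reduceProg) <|
  .seq (dotProg 7 7 2) <| .seq (block [.rconst 0 0])
    (.cond (.neq 4 7) (.cond (.req 2 0) .skip (block [.nadd 4 4 2])) .skip)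

def rowCost {R : Type*} [CommSemiring R] (n m : R) : R :=
  2 + (loadCost n m + ((2 + m * (reduceCost n m + 2)) + (dotCost n + (1 + (1 + (1 + 1))))))

/-- Stored rows are infinite sequences, but only their first n + m entries are meaningful and
updated. -/
theorem PartlyReduced.congr {n m : ℕ} {A : Matrix (Fin n) (Fin m) ℝ} {q : ℕ → Fin m}
    {B B' : ℕ → ℕ → ℝ} {t l : ℕ} {g g' : ℕ → ℝ} (h : PartlyReduced A q B t l g)
    (hB : ∀ j < l, B' j = B j) (hg : ∀ x < n + m, g' x = g x) :
    PartlyReduced A q B' t l g' := by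
  have hres : residue n g' = residue n g := funext fun x => hg x (by omega)
  have hco : coeff n m g' = coeff n m g := funext fun i => hg _ (by omega)
  refine ⟨⟨?_, ?_, ?_⟩, fun j hj => ?_⟩
  · rw [hco, hres]; exact h.row.aug
  · rw [hco]; exact h.row.lead
  · rw [hco]; exact h.row.supp
  · rw [hB j hj, hres]; exact h.orth j hj

theorem within_rowProg {n m : ℕ} {A : Matrix (Fin n) (Fin m) ℝ} {s : State} (hs : Env A s)
    {q : ℕ → Fin m} {t : ℕ} (ht : s.nreg 7 = t) (hqt : s.narr 2 (s.nreg 5 + t) = q t)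
    (htm : t < m) (hq : Set.InjOn q (Set.Iic t))
    (hG : GramSchmidt A q t (s.nreg 4) (s.rarr 2)) :
    Within rowProg s (rowCost n m) fun s' =>
      GramSchmidt A q (t + 1) (s'.nreg 4) (s'.rarr 2) := by
  refine .seq (Q := fun s' => s'.nreg 10 = q t) (.block rfl ?_) fun s₁ hf₁ h₁ => ?_
  · simp [Instr.apply, ht, hqt]
  have e₁ := hs.of_sameOutside hf₁ (by decide) (by decide)
  have h7₁ := (hf₁.nreg 7 (by decide)).trans ht
  have h4₁ := hf₁.nreg 4 (by decide)
  have hB₁ := hf₁.rarr 2 (by decide)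
  refine .seq (within_loadRow e₁ h₁) fun s₂ hf₂ ⟨h₂, h₂', h₂''⟩ => ?_
  have e₂ := e₁.of_sameOutside hf₂ (by decide) (by decide)
  have h7₂ := (hf₂.nreg 7 (by decide)).trans h7₁
  have h4₂ := (hf₂.nreg 4 (by decide)).trans h4₁
  rw [h7₁] at h₂ h₂' h₂''
  rw [hB₁] at h₂
  set K := s.nreg 4 with hK
  have hKt : K ≤ t := hG.le
  refine .seq (c := 2 + m * (reduceCost n m + 2))
    (Q := fun s' => (∀ r, r ≠ t → s'.rarr 2 r = s.rarr 2 r) ∧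
      PartlyReduced A q (s.rarr 2) t K (s'.rarr 2 t)) ?_ fun s₃ hf₃ ⟨h₃, h₃'⟩ => ?_
  · refine Within.mono (c := 2 + K * (reduceCost n m + 2)) (.forLoop
      (fun k s' => (∀ r, r ≠ t → s'.rarr 2 r = s.rarr 2 r) ∧
        PartlyReduced A q (s.rarr 2) t k (s'.rarr 2 t)) h4₂ e₂.one (by decide) (by decide)
      ⟨h₂, ⟨rowOf_unit h₂' h₂'', by simp⟩⟩ ?_ (fun s' _ h => h)) ?_ (fun _ _ h => h)
    · intro k s' hk hf hc ⟨hr, hp⟩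
      have e' := e₂.of_sameOutside hf (by decide) (by decide)
      have h7' := (hf.nreg 7 (by decide)).trans h7₂
      refine (within_reduceProg e' (by omega)).mono le_rfl fun s'' _ hpost => ?_
      rw [h7', hc] at hpost
      obtain ⟨hpr, hpx⟩ := hpost
      refine ⟨fun r hrt => by rw [State.setN_rarr, hpr r hrt, hr r hrt], ?_⟩
      rw [State.setN_rarr]
      rw [hr k (by omega)] at hpx
      exact (hp.step hG hq hk).congr (fun _ _ => rfl) hpx
    · have := Nat.mul_le_mul_right (reduceCost n m + 2) (hKt.trans htm.le)
      omega
  have e₃ := e₂.of_sameOutside hf₃ (by decide) (by decide)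
  have h7₃ := (hf₃.nreg 7 (by decide)).trans h7₂
  have h4₃ := (hf₃.nreg 4 (by decide)).trans h4₂
  refine .seq (within_dotProg e₃ (by decide) (by decide) (by decide) (by decide))
    fun s₄ hf₄ h₄ => ?_
  have e₄ := e₃.of_sameOutside hf₄ (by decide) (by decide)
  have h7₄ := (hf₄.nreg 7 (by decide)).trans h7₃
  have h4₄ := (hf₄.nreg 4 (by decide)).trans h4₃
  have hB₄ := hf₄.rarr 2 (by decide)
  rw [h7₃] at h₄
  refine .seq (Q := fun s' => s'.rreg 0 = 0) (.block rfl ?_) fun s₅ hf₅ h₅ => ?_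
  · simp [Instr.apply]
  have e₅ := e₄.of_sameOutside hf₅ (by decide) (by decide)
  have h7₅ := (hf₅.nreg 7 (by decide)).trans h7₄
  have h4₅ := (hf₅.nreg 4 (by decide)).trans h4₄
  have hB₅ := (hf₅.rarr 2 (by decide)).trans hB₄
  have hr₅ := (hf₅.rreg 2 (by decide)).trans h₄
  have hzero : s₅.rreg 2 = s₅.rreg 0 ↔ residue n (s₃.rarr 2 t) = 0 := by
    rw [h₅, hr₅, dotProduct_self_eq_zero]
  have key := fun K' (hK' : K' = if K = t ∧ residue n (s₃.rarr 2 t) ≠ 0 then K + 1 else K) =>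
    hG.step (B' := s₃.rarr 2) (fun j hj => h₃ j hj.ne) h₃' hK'
  refine .cond (fun hb => .cond (fun hb' => .skip ?_) fun hb' => .block rfl ?_)
    fun hb => .skip ?_
  · rw [Test.Holds, hzero] at hb'
    rw [hB₅, h4₅]
    exact key K (by simp [hb'])
  · rw [Test.Holds, hzero] at hb'
    rw [Test.Holds, h4₅, h7₅] at hb
    have := key (K + 1) (by simp [hb, hb'])
    simpa [Instr.apply, Function.update_apply, e₅.one, h4₅, hB₅] using this
  · rw [Test.Holds, h4₅, h7₅] at hb
    rw [hB₅, h4₅]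
    exact key K (by simp [hb])

/-- Orthogonalizes the columns listed in the array 2 from the offset in register 5 on; their number
is in register 6. -/
def gsProg : Prog := .seq (block [.nconst 4 0]) (forLoop 7 6 rowProg)

def gsCost {R : Type*} [CommSemiring R] (n m : R) : R := 1 + (2 + m * (rowCost n m + 2))

theorem within_gsProg {n m : ℕ} {A : Matrix (Fin n) (Fin m) ℝ} {s : State} (hs : Env A s)
    {q : ℕ → Fin m} {len : ℕ} (hlen : s.nreg 6 = len) (hm : len ≤ m)
    (hqs : ∀ t < len, s.narr 2 (s.nreg 5 + t) = q t) (hq : Set.InjOn q (Set.Iio len)) :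
    Within gsProg s (gsCost n m) fun s' =>
      GramSchmidt A q len (s'.nreg 4) (s'.rarr 2) := by
  refine .seq (Q := fun s' => s'.nreg 4 = 0) (.block rfl ?_) fun s₁ hf₁ h₁ => ?_
  · simp [Instr.apply]
  have e₁ := hs.of_sameOutside hf₁ (by decide) (by decide)
  have h6₁ := (hf₁.nreg 6 (by decide)).trans hlen
  have h5₁ := hf₁.nreg 5 (by decide)
  have hq₁ := hf₁.narr 2 (by decide)
  refine Within.mono (c := 2 + len * (rowCost n m + 2)) (.forLoop
    (fun t s' => GramSchmidt A q t (s'.nreg 4) (s'.rarr 2)) h6₁ e₁.one (by decide) (by decide)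
    ?_ ?_ (fun s' _ h => h)) ?_ (fun _ _ h => h)
  · simpa [h₁] using GramSchmidt.zero A q _
  · intro t s' ht hf hc hG
    have e' := e₁.of_sameOutside hf (by decide) (by decide)
    refine (within_rowProg e' hc ?_ (by omega) (hq.mono fun x hx => ?_) hG).mono le_rfl
      fun s'' _ h => ?_
    · rw [hf.narr 2 (by decide), hf.nreg 5 (by decide), hq₁, h5₁]
      exact hqs t ht
    · exact (Set.mem_Iic.1 hx).trans_lt ht
    · simpa using h
  · have := Nat.mul_le_mul_right (rowCost n m + 2) hm
    omega

/-! ### Finding the inliers -/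

/-- Sets up the constants, the list of columns (twice in a row) and the set of all columns. -/
def initProg : Prog :=
  .seq (block [.nconst 2 1, .nadd 13 0 1, .nadd 4 0 3, .nadd 6 1 3])
    (forLoop 20 1 (block [.nstore 2 20 20, .nadd 21 20 1, .nstore 2 21 20, .nstore 3 20 2]))

def initCost {R : Type*} [CommSemiring R] (m : R) : R := 4 + (2 + m * (4 + 2))

theorem within_initProg {n m : ℕ} (A : Matrix (Fin n) (Fin m) ℝ) :
    Within initProg (inputState A) (initCost m) fun s =>
      Env A s ∧ s.nreg 4 = n ∧ s.nreg 6 = m ∧ (∀ x, s.narr 1 x = 0) ∧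
      (∀ i < m, s.narr 2 i = i ∧ s.narr 2 (i + m) = i ∧ s.narr 3 i = 1) := by
  refine .seq (Q := fun s => Env A s ∧ s.nreg 4 = n ∧ s.nreg 6 = m ∧ (∀ x, s.narr 1 x = 0))
    (.block rfl ⟨?_, ?_, ?_, ?_⟩) fun s₁ hf₁ ⟨e₁, h4, h6, h1⟩ => ?_
  · constructor <;> simp [Instr.apply, inputState]
  · simp [Instr.apply, inputState]
  · simp [Instr.apply, inputState]
  · simp [Instr.apply, inputState]
  · refine .forLoop (fun k s => ∀ i < k, s.narr 2 i = i ∧ s.narr 2 (i + m) = i ∧ s.narr 3 i = 1)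
      e₁.cols e₁.one (by decide) (by decide) (by simp) ?_ ?_
    · intro t s ht hf hc h
      have e := e₁.of_sameOutside hf (by decide) (by decide)
      refine .block rfl fun i hi => ?_
      have h01 := e.cols
      have h02 := e.one
      by_cases hit : i = t
      · simp [Instr.apply, Function.update_apply, hc, h01, h02, hit]
      · have hne : i ≠ t + m := by omega
        have hne' : i + m ≠ t := by omega
        have := h i (by omega)
        simp [Instr.apply, hc, h01, hit, hne, hne', this]
    · intro s hf h
      exact ⟨e₁.of_sameOutside hf (by decide) (by decide), (hf.nreg 4 (by decide)).trans h4,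
        (hf.nreg 6 (by decide)).trans h6, fun x => by rw [hf.narr 1 (by decide)]; exact h1 x, h⟩

/-- The cyclic order of the columns from the column `σ` on. -/
def rotation (m : ℕ) [NeZero m] (σ : ℕ) (j : ℕ) : Fin m := Fin.ofNat m (σ + j)

theorem rotation_injOn {m : ℕ} [NeZero m] (σ : ℕ) : Set.InjOn (rotation m σ) (Set.Iio m) := by
  intro i hi j hj hij
  have hmod : (σ + i) ≡ (σ + j) [MOD m] := by
    simpa [rotation, Fin.ext_iff, Nat.ModEq] using hij
  exact (Nat.ModEq.add_left_cancel' σ hmod).eq_of_lt_of_lt hi hj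

theorem rotation_surjective {m : ℕ} [NeZero m] (σ : ℕ) (i : Fin m) :
    ∃ j < m, rotation m σ j = i := by
  have hinj : Function.Injective fun j : Fin m => rotation m σ j := fun a b hab =>
    Fin.ext (rotation_injOn σ a.2 b.2 hab)
  obtain ⟨j, hj⟩ := (Finite.injective_iff_surjective.1 hinj) i
  exact ⟨j, j.2, hj⟩

/-- Orthogonalizes rotations of the columns until the first `n` columns turn out dependent. -/
def searchProg : Prog :=
  forLoop 22 1 (.cond (.nlt 4 0) .skip (.seq (block [.nadd 5 22 3]) gsProg))

def searchCost {R : Type*} [CommSemiring R] (n m : R) : R :=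
  2 + m * ((1 + (1 + gsCost n m)) + 2)

/-- The offset in register 5 and the number of orthogonal rows in register 4 belong to a rotation
whose first `n` columns are dependent. -/
structure Found {n m : ℕ} [NeZero m] (A : Matrix (Fin n) (Fin m) ℝ) (s : State) : Prop where
  lt : s.nreg 4 < n
  offset : s.nreg 5 < m
  gs : GramSchmidt A (rotation m (s.nreg 5)) m (s.nreg 4) (s.rarr 2)

section

variable {n m d : ℕ} {A : Matrix (Fin n) (Fin m) ℝ} {T : Submodule ℝ (Fin n → ℝ)}

/-- Register 4 starts at n, so the test K < n first succeeds after an orthogonalization that stopped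
early; the later iterations then leave the result alone. Failure at every offset would contradict
`exists_window`. -/
theorem within_searchProg [NeZero m] (h : InlierModel A T d) {s : State} (hs : Env A s)
    (h4 : s.nreg 4 = n) (h6 : s.nreg 6 = m)
    (hlist : ∀ σ < m, ∀ j < m, s.narr 2 (σ + j) = rotation m σ j) :
    Within searchProg s (searchCost n m) (Found A) := by
  refine .forLoop (fun k s' => Found A s' ∨ n ≤ s'.nreg 4 ∧ ∀ σ < k,
      (((Finset.range n).image (rotation m σ)) ∩ inliers A T).card ≤ d)
    hs.cols hs.one (by decide) (by decide) (Or.inr (by simp [h4])) ?_ ?_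
  · intro t s₁ ht hf hc hinv
    have e₁ := hs.of_sameOutside hf (by decide) (by decide)
    refine .cond (fun hb => .skip ?_) fun hb => ?_
    · rw [Test.Holds, e₁.rows] at hb
      refine Or.inl ?_
      obtain hF | hF := hinv
      · exact ⟨by simpa using hF.lt, by simpa using hF.offset, by simpa using hF.gs⟩
      · omega
    · rw [Test.Holds, e₁.rows] at hb
      obtain hF | ⟨-, hall⟩ := hinv
      · exact absurd hF.lt hb
      refine .seq (Q := fun s' => s'.nreg 5 = t) (.block rfl ?_) fun s₂ hf₂ h5 => ?_
      · simp [Instr.apply, hc, e₁.zero]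
      have e₂ := e₁.of_sameOutside hf₂ (by decide) (by decide)
      refine (within_gsProg e₂ (q := rotation m t) (len := m) ?_ le_rfl ?_
        (rotation_injOn t)).mono le_rfl fun s₃ hf₃ hG => ?_
      · rw [hf₂.nreg 6 (by decide), hf.nreg 6 (by decide), h6]
      · intro j hj
        rw [hf₂.narr 2 (by decide), hf.narr 2 (by decide), h5, hlist t ht j hj]
      have h5₃ := (hf₃.nreg 5 (by decide)).trans h5
      by_cases hd : d < (((Finset.range n).image (rotation m t)) ∩ inliers A T).card
      · have hlt := h.lt_of_window hG hd
        refine Or.inl ⟨by simpa using hlt, by simpa [h5₃] using ht, by simpa [h5₃] using hG⟩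
      · by_cases hlt : s₃.nreg 4 < n
        · refine Or.inl ⟨by simpa using hlt, by simpa [h5₃] using ht, by simpa [h5₃] using hG⟩
        · refine Or.inr ⟨by simpa using hlt, fun σ hσ => ?_⟩
          rcases Nat.lt_succ_iff_lt_or_eq.1 hσ with hσ | rfl
          · exact hall σ hσ
          · omega
  · intro s' _ hinv
    obtain hF | ⟨-, hall⟩ := hinv
    · exact hF
    · obtain ⟨σ, hσ, hd⟩ := h.exists_window
      exact absurd (hall σ hσ) (not_le.2 hd)

/-- Marks the columns that occur in the kernel vectors of the rows with residue zero. -/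
def markProg : Prog :=
  forLoop 7 1 <| .seq (dotProg 7 7 2) <| .seq (block [.rconst 0 0]) <|
    .cond (.req 2 0) (forLoop 8 1 <| .seq (block [.nadd 11 0 8, .rload 3 2 7 11])
      (.cond (.req 3 0) .skip (block [.nstore 1 8 2]))) .skip

def markCost {R : Type*} [CommSemiring R] (n m : R) : R :=
  2 + m * ((dotCost n + (1 + (1 + (2 + m * ((2 + (1 + 1)) + 2))))) + 2)

/-- The array `a` is the indicator of the predicate `p`. -/
def Marks {m : ℕ} (a : ℕ → ℕ) (p : Fin m → Prop) : Prop :=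
  ∀ i : Fin m, a i ≤ 1 ∧ (a i = 1 ↔ p i)

theorem Marks.congr {a : ℕ → ℕ} {p p' : Fin m → Prop} (h : Marks a p) (hp : ∀ i, p i ↔ p' i) :
    Marks a p' :=
  fun i => ⟨(h i).1, (h i).2.trans (hp i)⟩

theorem Marks.eq_ite {a : ℕ → ℕ} {p : Fin m → Prop} (h : Marks a p) (i : Fin m) [Decidable (p i)] :
    a i = if p i then 1 else 0 := by
  have h1 := (h i).1
  split_ifs with hp
  · exact (h i).2.2 hp
  · have : a i ≠ 1 := fun he => hp ((h i).2.1 he)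
    omega

theorem within_markProg {s : State} (hs : Env A s) (h0 : ∀ x, s.narr 1 x = 0) :
    Within markProg s (markCost n m) fun s' => Marks (s'.narr 1) fun i : Fin m =>
      ∃ j < m, residue n (s.rarr 2 j) = 0 ∧ coeff n m (s.rarr 2 j) i ≠ 0 := by
  refine .forLoop (fun k s' => Marks (s'.narr 1) fun i : Fin m =>
      ∃ j < k, residue n (s.rarr 2 j) = 0 ∧ coeff n m (s.rarr 2 j) i ≠ 0)
    hs.cols hs.one (by decide) (by decide) (fun i => by simp [h0]) ?_ (fun _ _ h => h)
  intro t s₁ ht hf₁ hc₁ h₁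
  have e₁ := hs.of_sameOutside hf₁ (by decide) (by decide)
  have hB₁ := hf₁.rarr 2 (by decide)
  refine .seq (within_dotProg e₁ (by decide) (by decide) (by decide) (by decide))
    fun s₂ hf₂ h₂ => ?_
  have e₂ := e₁.of_sameOutside hf₂ (by decide) (by decide)
  rw [hc₁, hB₁] at h₂
  refine .seq (Q := fun s' => s'.rreg 0 = 0) (.block rfl (by simp [Instr.apply]))
    fun s₃ hf₃ h₃ => ?_
  have e₃ := e₂.of_sameOutside hf₃ (by decide) (by decide)
  have hr₃ := (hf₃.rreg 2 (by decide)).trans h₂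
  have hB₃ := (hf₃.rarr 2 (by decide)).trans ((hf₂.rarr 2 (by decide)).trans hB₁)
  have h7₃ := (hf₃.nreg 7 (by decide)).trans ((hf₂.nreg 7 (by decide)).trans hc₁)
  have hM₃ := (hf₃.narr 1 (by decide)).trans (hf₂.narr 1 (by decide))
  have hsucc : ∀ i : Fin m, (∃ j < t + 1, residue n (s.rarr 2 j) = 0 ∧
      coeff n m (s.rarr 2 j) i ≠ 0) ↔ (∃ j < t, residue n (s.rarr 2 j) = 0 ∧
      coeff n m (s.rarr 2 j) i ≠ 0) ∨ residue n (s.rarr 2 t) = 0 ∧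
      coeff n m (s.rarr 2 t) i ≠ 0 := by
    intro i
    constructor
    · rintro ⟨j, hj, hj'⟩
      rcases Nat.lt_succ_iff_lt_or_eq.1 hj with hj | rfl
      · exact Or.inl ⟨j, hj, hj'⟩
      · exact Or.inr hj'
    · rintro (⟨j, hj, hj'⟩ | hj')
      · exact ⟨j, hj.trans (Nat.lt_succ_self t), hj'⟩
      · exact ⟨t, Nat.lt_succ_self t, hj'⟩
  refine .cond (fun hb => ?_) fun hb => .skip ?_
  · rw [Test.Holds, h₃, hr₃, dotProduct_self_eq_zero] at hb
    refine .forLoop (fun k s' => Marks (s'.narr 1) fun i : Fin m =>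
        (∃ j < t, residue n (s.rarr 2 j) = 0 ∧ coeff n m (s.rarr 2 j) i ≠ 0) ∨
          (i : ℕ) < k ∧ coeff n m (s.rarr 2 t) i ≠ 0) e₃.cols e₃.one (by decide) (by decide)
      ?_ ?_ ?_
    · rw [State.setN_narr, hM₃]
      exact h₁.congr fun i => by simp
    · intro x s₄ hx hf₄ hc₄ h₄
      have e₄ := e₃.of_sameOutside hf₄ (by decide) (by decide)
      have hr0 := (hf₄.rreg 0 (by decide)).trans h₃
      have hB₄ := (hf₄.rarr 2 (by decide)).trans hB₃
      have h7₄ := (hf₄.nreg 7 (by decide)).trans h7₃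
      refine .seq (Q := fun s' => s'.rreg 3 = coeff n m (s.rarr 2 t) ⟨x, hx⟩) (.block rfl ?_)
        fun s₅ hf₅ h₅ => ?_
      · simp [Instr.apply, coeff, hB₄, h7₄, e₄.rows, hc₄]
      have e₅ := e₄.of_sameOutside hf₅ (by decide) (by decide)
      have hr0' := (hf₅.rreg 0 (by decide)).trans hr0
      have hM₅ := hf₅.narr 1 (by decide)
      have h8₅ := (hf₅.nreg 8 (by decide)).trans hc₄
      refine .cond (fun hb' => .skip ?_) fun hb' => .block rfl ?_
      · rw [Test.Holds, hr0', h₅] at hb'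
        rw [State.setN_narr, hM₅]
        refine h₄.congr fun i => or_congr_right ⟨fun hi => ⟨by omega, hi.2⟩, fun hi => ⟨?_, hi.2⟩⟩
        have : (i : ℕ) ≠ x := fun he => hi.2 (by
          have : i = ⟨x, hx⟩ := Fin.ext he
          rw [this, hb'])
        omega
      · rw [Test.Holds, hr0', h₅] at hb'
        intro i
        by_cases hix : (i : ℕ) = x
        · have : i = ⟨x, hx⟩ := Fin.ext hix
          subst this
          simp [Instr.apply, h8₅, e₅.one, hb']
        · have hlt : (i : ℕ) < x + 1 ↔ (i : ℕ) < x := by omega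
          simpa [Instr.apply, Function.update_apply, h8₅, hix, hlt, hM₅] using h₄ i
    · intro s₄ _ h₄
      rw [State.setN_narr]
      exact h₄.congr fun i => by rw [hsucc]; simp [hb]
  · rw [Test.Holds, h₃, hr₃, dotProduct_self_eq_zero] at hb
    rw [State.setN_narr, hM₃]
    exact h₁.congr fun i => by rw [hsucc]; simp [hb]

/-- Counts the marked columns among the first `K` columns of the rotation, and all marked
columns. -/
def countProg : Prog :=
  .seq (block [.nconst 23 0]) <|
  .seq (forLoop 8 4 (block [.nadd 11 5 8, .nload 10 2 11, .nload 12 1 10, .nadd 23 23 12])) <|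
  .seq (block [.nconst 24 0]) (forLoop 8 1 (block [.nload 12 1 8, .nadd 24 24 12]))

def countCost {R : Type*} [CommSemiring R] (n m : R) : R :=
  1 + ((2 + n * (4 + 2)) + (1 + (2 + m * (2 + 2))))

/-- The dimension d is not part of the input; by `card_prefix_inter` it is the number of inliers
among the first K columns of the rotation. -/
theorem within_countProg [NeZero m] (h : InlierModel A T d) {s : State} (hs : Env A s)
    (hF : Found A s) (hM : Marks (s.narr 1) fun i => i ∈ inliers A T)
    (hlist : ∀ σ < m, ∀ j < m, s.narr 2 (σ + j) = rotation m σ j) :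
    Within countProg s (countCost n m) fun s' =>
      s'.nreg 23 = d ∧ s'.nreg 24 = (inliers A T).card := by
  have hKm : s.nreg 4 < m := hF.lt.trans_le h.le
  refine .seq (Q := fun s' => s'.nreg 23 = 0) (.block rfl (by simp [Instr.apply]))
    fun s₁ hf₁ h₁ => ?_
  have e₁ := hs.of_sameOutside hf₁ (by decide) (by decide)
  refine .seq (Q := fun s' => s'.nreg 23 = d) (c := 2 + n * (4 + 2)) ?_ fun s₂ hf₂ h₂ => ?_
  · refine Within.mono (c := 2 + s.nreg 4 * (4 + 2)) (.forLoop (fun k s' => s'.nreg 23 =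
        ∑ j ∈ Finset.range k, if rotation m (s.nreg 5) j ∈ inliers A T then 1 else 0)
      (hf₁.nreg 4 (by decide)) e₁.one (by decide) (by decide) (by simpa using h₁) ?_
      (fun _ _ h => h)) ?_ ?_
    · intro t s₂ ht hf₂ hc₂ h₂
      have h5 := (hf₂.nreg 5 (by decide)).trans (hf₁.nreg 5 (by decide))
      have hq := (hf₂.narr 2 (by decide)).trans (hf₁.narr 2 (by decide))
      have hm := (hf₂.narr 1 (by decide)).trans (hf₁.narr 1 (by decide))
      refine .block rfl ?_
      rw [Finset.sum_range_succ, ← h₂]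
      simp [Instr.apply, h5, hq, hm, hc₂, hlist _ hF.offset t (ht.trans hKm), hM.eq_ite]
    · have := hF.lt
      omega
    · intro s₂ _ h₂
      rw [h₂, ← Finset.card_filter, ← h.card_prefix_inter hF.gs hF.lt hKm,
        ← Finset.filter_mem_eq_inter, Finset.filter_image, Finset.card_image_of_injOn]
      intro a ha b hb hab
      simp only [Finset.coe_filter, Finset.mem_range, Set.mem_ofPred_eq] at ha hb
      exact rotation_injOn (s.nreg 5) (ha.1.trans hKm) (hb.1.trans hKm) hab
  have e₂ := e₁.of_sameOutside hf₂ (by decide) (by decide)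
  refine .seq (Q := fun s' => s'.nreg 24 = 0) (.block rfl (by simp [Instr.apply]))
    fun s₃ hf₃ h₃ => ?_
  have e₃ := e₂.of_sameOutside hf₃ (by decide) (by decide)
  have hm₃ := (hf₃.narr 1 (by decide)).trans ((hf₂.narr 1 (by decide)).trans
    (hf₁.narr 1 (by decide)))
  refine .forLoop (fun k s' => s'.nreg 24 = ∑ j ∈ Finset.range k, s.narr 1 j)
    e₃.cols e₃.one (by decide) (by decide) (by simpa using h₃) ?_ ?_
  · intro t s₄ ht hf₄ hc₄ h₄
    have hm₄ := (hf₄.narr 1 (by decide)).trans hm₃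
    refine .block rfl ?_
    simp [Instr.apply, hm₄, hc₄, h₄, Finset.sum_range_succ]
  · intro s₄ hf₄ h₄
    refine ⟨?_, ?_⟩
    · rw [hf₄.nreg 23 (by decide), hf₃.nreg 23 (by decide), h₂]
    · rw [h₄, ← Fin.sum_univ_eq_sum_range]
      simp [hM.eq_ite]

end

/-! ### Carrying out the algorithm -/

section

variable {n m d : ℕ} {A : Matrix (Fin n) (Fin m) ℝ} {T : Submodule ℝ (Fin n → ℝ)}

/-- For an outlier the answer is always NO, and for an inlier it does not depend on which one. One
comparison per iteration therefore settles the whole scan. -/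
theorem InlierModel.answersNo_erase_iff (h : InlierModel A T d) {U : Finset (Fin m)}
    (hU : n < U.card) (hinv : d * U.card < n * (U ∩ inliers A T).card) {i : Fin m} (hi : i ∈ U) :
    AnswersNo A (U.erase i) ↔ (i ∈ inliers A T →
      d * (U.card - 1) < n * ((U ∩ inliers A T).card - 1)) := by
  have hc := Finset.card_erase_of_mem hi
  rw [h.answersNo_iff (by omega), hc, Finset.erase_inter]
  by_cases hiL : i ∈ inliers A T
  · rw [Finset.card_erase_of_mem (Finset.mem_inter.2 ⟨hi, hiL⟩)]
    simp [hiL]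
  · rw [Finset.erase_eq_of_notMem (by simp [hiL])]
    simp only [hiL, false_imp_iff, iff_true]
    exact (Nat.mul_le_mul_left d (Nat.sub_le _ _)).trans_lt hinv

/-- Sets register 28 to the first remaining column that is not an inlier, or to the first
remaining column if register 27 is one. -/
def findProg : Prog :=
  .seq (block [.nadd 28 1 3]) <| forLoop 8 1 <| .cond (.neq 28 1)
    (.seq (block [.nload 10 3 8, .nload 11 1 8, .nsub 11 11 27, .nsub 10 10 11])
      (.cond (.neq 10 2) (block [.nadd 28 8 3]) .skip)) .skip

def findCost {R : Type*} [CommSemiring R] (m : R) : R :=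
  1 + (2 + m * ((1 + (4 + (1 + 1))) + 2))

theorem within_findProg {s : State} (hs : Env A s) {U L : Finset (Fin m)} {z : Prop}
    (hU : Marks (s.narr 3) (· ∈ U)) (hL : Marks (s.narr 1) (· ∈ L)) (hz : s.nreg 27 ≤ 1)
    (hz' : s.nreg 27 = 1 ↔ z) (hex : ∃ i ∈ U, i ∈ L → z) :
    Within findProg s (findCost m) fun s' => ∃ i : Fin m, s'.nreg 28 = i ∧ i ∈ U ∧
      (i ∈ L → z) ∧ ∀ j ∈ U, j < i → ¬ (j ∈ L → z) := by
  refine .seq (Q := fun s' => s'.nreg 28 = m) (.block rfl ?_) fun s₁ hf₁ h₁ => ?_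
  · simp [Instr.apply, hs.cols, hs.zero]
  have e₁ := hs.of_sameOutside hf₁ (by decide) (by decide)
  -- The value m, which is no column index, stands for "not found yet".
  refine .forLoop (fun k s' => (s'.nreg 28 = m ∧ ∀ j ∈ U, (j : ℕ) < k → ¬ (j ∈ L → z)) ∨
    ∃ i : Fin m, s'.nreg 28 = i ∧ i ∈ U ∧ (i ∈ L → z) ∧ ∀ j ∈ U, j < i → ¬ (j ∈ L → z))
    e₁.cols e₁.one (by decide) (by decide) (Or.inl (by simp [h₁])) ?_ ?_
  · intro t s₂ ht hf₂ hc₂ h₂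
    have e₂ := e₁.of_sameOutside hf₂ (by decide) (by decide)
    refine .cond (fun hb => ?_) fun hb => .skip ?_
    · rw [Test.Holds, e₂.cols] at hb
      have hnone : ∀ j ∈ U, (j : ℕ) < t → ¬ (j ∈ L → z) := by
        obtain h₂ | ⟨i, hi, -⟩ := h₂
        · exact h₂.2
        · have := i.2
          omega
      have h27 := (hf₂.nreg 27 (by decide)).trans (hf₁.nreg 27 (by decide))
      have ha := (hf₂.narr 3 (by decide)).trans (hf₁.narr 3 (by decide))
      have hm := (hf₂.narr 1 (by decide)).trans (hf₁.narr 1 (by decide))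
      -- On values 0 and 1 the truncated difference a - (l - z) is one exactly when a holds and l
      -- implies z.
      refine .seq (Q := fun s' => s'.nreg 10 = 1 ↔ (⟨t, ht⟩ : Fin m) ∈ U ∧
        ((⟨t, ht⟩ : Fin m) ∈ L → z)) (.block rfl ?_) fun s₃ hf₃ h₃ => ?_
      · obtain ⟨ha1, ha2⟩ := hU ⟨t, ht⟩
        obtain ⟨hm1, hm2⟩ := hL ⟨t, ht⟩
        simp only [Instr.apply, List.foldl, Function.update_apply]
        simp only [hc₂, ha, hm, h27] at *
        norm_num
        rw [← ha2, ← hm2, ← hz']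
        omega
      have h28 := (hf₃.nreg 28 (by decide)).trans hb
      have h8 := (hf₃.nreg 8 (by decide)).trans hc₂
      have e₃ := e₂.of_sameOutside hf₃ (by decide) (by decide)
      refine .cond (fun hb' => .block rfl ?_) fun hb' => .skip ?_
      · rw [Test.Holds, e₃.one, h₃] at hb'
        exact Or.inr ⟨⟨t, ht⟩, by simp [Instr.apply, h8, e₃.zero], hb'.1, hb'.2,
          fun j hj hjt => hnone j hj hjt⟩
      · rw [Test.Holds, e₃.one, h₃] at hb'
        refine Or.inl ⟨by simpa using h28, fun j hj hjt => ?_⟩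
        rcases Nat.lt_succ_iff_lt_or_eq.1 hjt with hjt | hjt
        · exact hnone j hj hjt
        · have : j = ⟨t, ht⟩ := Fin.ext hjt
          subst this
          exact fun hi => hb' ⟨hj, hi⟩
    · rw [Test.Holds, e₂.cols] at hb
      obtain h₂ | h₂ := h₂
      · exact absurd h₂.1 hb
      · exact Or.inr (by simpa using h₂)
  · intro s₂ _ h₂
    obtain ⟨-, hnone⟩ | h₂ := h₂
    · obtain ⟨i, hi, hc⟩ := hex
      exact absurd hc (hnone i hi i.2)
    · exact h₂

/-- One iteration of the while loop. -/
def deleteProg : Prog :=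
  .seq (block [.nsub 26 26 2, .nsub 21 24 2, .rofNat 0 0, .rofNat 2 21, .rmul 0 0 2, .rofNat 1 23,
    .rofNat 4 26, .rmul 1 1 4, .nconst 27 0]) <|
  .seq (.cond (.rlt 1 0) (block [.nconst 27 1]) .skip) <| .seq findProg
    (block [.nstore 0 20 28, .nstore 3 28 3, .nload 10 1 28, .nsub 24 24 10])

def deleteCost {R : Type*} [CommSemiring R] (m : R) : R := 9 + ((1 + 1) + (findCost m + 4))

/-- After the deletion of the columns in `D` the columns in `U` remain. -/
structure Deleted (A : Matrix (Fin n) (Fin m) ℝ) (T : Submodule ℝ (Fin n → ℝ)) (d : ℕ)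
    (D : List (Fin m)) (U : Finset (Fin m)) (s : State) : Prop where
  alive : Marks (s.narr 3) (· ∈ U)
  out : ∀ (k : ℕ) (hk : k < D.length), s.narr 0 k = (D[k] : ℕ)
  card : U.card + D.length = m
  size : s.nreg 26 = U.card
  count : s.nreg 24 = (U ∩ inliers A T).card
  inv : d * U.card < n * (U ∩ inliers A T).card
  run : ∀ D' W, LoopRun A (Equiv.refl _) U D' W →
    LoopRun A (Equiv.refl _) Finset.univ (D ++ D') W

theorem within_deleteProg (h : InlierModel A T d) {s : State} (hs : Env A s)
    (hM : Marks (s.narr 1) (· ∈ inliers A T)) (hd : s.nreg 23 = d) {D : List (Fin m)}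
    {U : Finset (Fin m)} (hD : Deleted A T d D U s) (hU : n < U.card)
    (h20 : s.nreg 20 = D.length) :
    Within deleteProg s (deleteCost m) fun s' => ∃ i, Deleted A T d (D ++ [i]) (U.erase i) s' := by
  set z : Prop := d * (U.card - 1) < n * ((U ∩ inliers A T).card - 1) with hzdef
  refine .seq (Q := fun s' => s'.nreg 26 = U.card - 1 ∧ s'.nreg 24 = (U ∩ inliers A T).card ∧
    s'.nreg 27 = 0 ∧ s'.rreg 1 = (d : ℝ) * (U.card - 1 : ℕ) ∧
    s'.rreg 0 = (n : ℝ) * ((U ∩ inliers A T).card - 1 : ℕ)) (.block rfl ?_)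
    fun s₁ hf₁ ⟨h26, h24, h27, hr1, hr0⟩ => ?_
  · simp [Instr.apply, hs.one, hs.rows, hd, hD.size, hD.count]
  have e₁ := hs.of_sameOutside hf₁ (by decide) (by decide)
  refine .seq (Q := fun s' => s'.nreg 27 ≤ 1 ∧ (s'.nreg 27 = 1 ↔ z)) ?_
    fun s₂ hf₂ ⟨hz, hz'⟩ => ?_
  -- Natural registers cannot be multiplied, so the two products are formed and compared exactly as
  -- reals.
  · have hlt : s₁.rreg 1 < s₁.rreg 0 ↔ z := by
      rw [hr1, hr0, hzdef]; exact_mod_cast Iff.rfl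
    refine .cond (fun hb => .block rfl ?_) fun hb => .skip ?_
    · rw [Test.Holds, hlt] at hb
      simp [Instr.apply, hb]
    · rw [Test.Holds, hlt] at hb
      simp [h27, hb]
  have e₂ := e₁.of_sameOutside hf₂ (by decide) (by decide)
  have ha := (hf₂.narr 3 (by decide)).trans (hf₁.narr 3 (by decide))
  have hm := (hf₂.narr 1 (by decide)).trans (hf₁.narr 1 (by decide))
  have hex : ∃ i ∈ U, i ∈ inliers A T → z := by
    obtain ⟨i, hi, hno⟩ := h.exists_answersNo hU hD.inv
    exact ⟨i, hi, (h.answersNo_erase_iff hU hD.inv hi).1 hno⟩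
  refine .seq (within_findProg e₂ (by rw [ha]; exact hD.alive) (by rw [hm]; exact hM) hz hz' hex)
    fun s₃ hf₃ ⟨i, h28, hiU, hi, hmin⟩ => .block rfl ⟨i, ?_⟩
  have e₃ := e₂.of_sameOutside hf₃ (by decide) (by decide)
  have ha₃ := (hf₃.narr 3 (by decide)).trans ha
  have hm₃ := (hf₃.narr 1 (by decide)).trans hm
  have h0₃ := (hf₃.narr 0 (by decide)).trans ((hf₂.narr 0 (by decide)).trans
    (hf₁.narr 0 (by decide)))
  have h20₃ := (hf₃.nreg 20 (by decide)).trans ((hf₂.nreg 20 (by decide)).trans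
    ((hf₁.nreg 20 (by decide)).trans h20))
  have h26₃ := (hf₃.nreg 26 (by decide)).trans ((hf₂.nreg 26 (by decide)).trans h26)
  have h24₃ := (hf₃.nreg 24 (by decide)).trans ((hf₂.nreg 24 (by decide)).trans h24)
  have hno := (h.answersNo_erase_iff hU hD.inv hiU).2 hi
  have hcard := Finset.card_erase_of_mem hiU
  have hL := Finset.card_pos.2 ⟨i, hiU⟩
  refine ⟨fun j => ?_, fun k hk => ?_, ?_, ?_, ?_, ?_, fun D' W hrun => ?_⟩
  · by_cases hji : j = i
    · simp [Instr.apply, h28, e₃.zero, hji]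
    · have hji' : (j : ℕ) ≠ i := fun he => hji (Fin.ext he)
      simpa [Instr.apply, h28, hji, hji', ha₃] using hD.alive j
  · rw [List.length_append, List.length_singleton] at hk
    by_cases hkD : k = D.length
    · subst hkD
      simp [Instr.apply, h20₃, h28]
    · have hk' : k < D.length := by omega
      simpa [Instr.apply, h20₃, hkD, List.getElem_append_left hk', h0₃] using hD.out k hk'
  · have := hD.card
    simp only [List.length_append, List.length_singleton]
    omega
  · simp [Instr.apply, h26₃, hcard]
  · rw [Finset.erase_inter]
    by_cases hiL : i ∈ inliers A T
    · rw [Finset.card_erase_of_mem (Finset.mem_inter.2 ⟨hiU, hiL⟩)]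
      simp [Instr.apply, h28, hm₃, h24₃, hM.eq_ite, hiL]
    · rw [Finset.erase_eq_of_notMem (by simp [hiL])]
      simp [Instr.apply, h28, hm₃, h24₃, hM.eq_ite, hiL]
  · exact (h.answersNo_iff (by omega)).1 hno
  -- `LoopRun` grows at the front while D grows at the back; the continuation form of `run` absorbs
  -- the new deletion.
  · rw [List.append_assoc]
    refine hD.run _ _ (.delete U W i D' hU hiU hno (fun j hj hji hnoj => ?_) hrun)
    exact hmin j hj hji ((h.answersNo_erase_iff hU hD.inv hj).1 hnoj)

/-- The while loop. -/
def loopProg : Prog :=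
  .seq (block [.nsub 25 1 0, .nadd 26 1 3]) (forLoop 20 25 deleteProg)

def loopCost {R : Type*} [CommSemiring R] (m : R) : R := 2 + (2 + m * (deleteCost m + 2))

/-- Every iteration deletes exactly one column, so the while loop can be run as a counting loop of m
- n rounds. -/
theorem within_loopProg (h : InlierModel A T d) {s : State} (hs : Env A s)
    (hM : Marks (s.narr 1) (· ∈ inliers A T)) (hd : s.nreg 23 = d)
    (hl : s.nreg 24 = (inliers A T).card) (ha : ∀ i < m, s.narr 3 i = 1) :
    Within loopProg s (loopCost m) fun s' => ∃ D U, U.card = n ∧ Deleted A T d D U s' := by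
  refine .seq (Q := fun s' => s'.nreg 25 = m - n ∧ s'.nreg 26 = m) (.block rfl ?_)
    fun s₁ hf₁ ⟨h25, h26⟩ => ?_
  · simp [Instr.apply, hs.cols, hs.rows, hs.zero]
  have e₁ := hs.of_sameOutside hf₁ (by decide) (by decide)
  refine Within.mono (c := 2 + (m - n) * (deleteCost m + 2)) (.forLoop
    (fun t s' => ∃ D U, D.length = t ∧ Deleted A T d D U s') h25 e₁.one (by decide) (by decide)
    ⟨[], Finset.univ, rfl, ?_⟩ ?_ ?_) ?_ (fun _ _ h => h)
  · refine ⟨fun i => ?_, by simp, by simp, by simpa using h26, ?_, h.univ_invariant,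
      fun D' W hrun => hrun⟩
    · rw [State.setN_narr, hf₁.narr 3 (by decide), ha i i.2]
      simp
    · simpa [hf₁.nreg 24 (by decide)] using hl
  · rintro t s₂ ht hf₂ hc₂ ⟨D, U, rfl, hD⟩
    have e₂ := e₁.of_sameOutside hf₂ (by decide) (by decide)
    have hm₂ := (hf₂.narr 1 (by decide)).trans (hf₁.narr 1 (by decide))
    have hd₂ := (hf₂.nreg 23 (by decide)).trans ((hf₁.nreg 23 (by decide)).trans hd)
    have hcard := hD.card
    refine (within_deleteProg h e₂ (by rw [hm₂]; exact hM) hd₂ hD (by omega) hc₂).mono le_rfl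
      fun s₃ _ ⟨i, hi⟩ => ⟨D ++ [i], U.erase i, by simp, ?_⟩
    exact ⟨hi.alive, hi.out, hi.card, by simpa using hi.size, by simpa using hi.count, hi.inv,
      hi.run⟩
  · rintro s₂ - ⟨D, U, hlen, hD⟩
    have := hD.card
    have := h.le
    exact ⟨D, U, by omega, hD⟩
  · have := Nat.mul_le_mul_right (deleteCost m + 2) (Nat.sub_le m n)
    omega

/-- Lists the remaining columns in the array 2. -/
def collectProg : Prog :=
  .seq (block [.nconst 29 0]) <| forLoop 8 1 <| .seq (block [.nload 10 3 8])
    (.cond (.neq 10 2) (block [.nstore 2 29 8, .nadd 29 29 2]) .skip)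

def collectCost {R : Type*} [CommSemiring R] (m : R) : R :=
  1 + (2 + m * ((1 + (1 + 2)) + 2))

theorem within_collectProg {s : State} (hs : Env A s) {U : Finset (Fin m)}
    (hU : Marks (s.narr 3) (· ∈ U)) :
    Within collectProg s (collectCost m) fun s' => ∃ l : List (Fin m), l.Nodup ∧
      (∀ i, i ∈ l ↔ i ∈ U) ∧ ∀ (x : ℕ) (hx : x < l.length), s'.narr 2 x = (l[x] : ℕ) := by
  refine .seq (Q := fun s' => s'.nreg 29 = 0) (.block rfl (by simp [Instr.apply]))
    fun s₁ hf₁ h₁ => ?_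
  have e₁ := hs.of_sameOutside hf₁ (by decide) (by decide)
  refine .forLoop (fun k s' => ∃ l : List (Fin m), l.Nodup ∧ (∀ i, i ∈ l ↔ i ∈ U ∧ (i : ℕ) < k) ∧
      s'.nreg 29 = l.length ∧ ∀ (x : ℕ) (hx : x < l.length), s'.narr 2 x = (l[x] : ℕ))
    e₁.cols e₁.one (by decide) (by decide) ⟨[], by simp [h₁]⟩ ?_ ?_
  · rintro t s₂ ht hf₂ hc₂ ⟨l, hl, hmem, h29, hx⟩
    have e₂ := e₁.of_sameOutside hf₂ (by decide) (by decide)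
    have ha := (hf₂.narr 3 (by decide)).trans (hf₁.narr 3 (by decide))
    refine .seq (Q := fun s' => s'.nreg 10 = 1 ↔ (⟨t, ht⟩ : Fin m) ∈ U) (.block rfl ?_)
      fun s₃ hf₃ h₃ => ?_
    · simpa [Instr.apply, hc₂, ha] using (hU ⟨t, ht⟩).2
    have e₃ := e₂.of_sameOutside hf₃ (by decide) (by decide)
    have h8 := (hf₃.nreg 8 (by decide)).trans hc₂
    have h29₃ := (hf₃.nreg 29 (by decide)).trans h29
    have hq₃ := hf₃.narr 2 (by decide)
    refine .cond (fun hb => .block rfl ⟨l ++ [⟨t, ht⟩], ?_, fun i => ?_, ?_, fun x hxl => ?_⟩)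
      fun hb => .skip ⟨l, hl, fun i => ?_, by simpa using h29₃, fun x hxl => ?_⟩
    · rw [List.nodup_append]
      refine ⟨hl, by simp, fun a ha b hb hab => ?_⟩
      rw [hmem] at ha
      rw [hab, List.mem_singleton.1 hb] at ha
      exact lt_irrefl _ ha.2
    · rw [Test.Holds, e₃.one, h₃] at hb
      rw [List.mem_append, hmem, List.mem_singleton, Fin.ext_iff]
      constructor
      · rintro (hi | hi)
        · exact ⟨hi.1, by omega⟩
        · have : i = ⟨t, ht⟩ := Fin.ext hi
          exact ⟨this ▸ hb, by simp [hi]⟩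
      · rintro ⟨hi, hit⟩
        rcases Nat.lt_succ_iff_lt_or_eq.1 hit with hit | hit
        · exact Or.inl ⟨hi, hit⟩
        · exact Or.inr hit
    · simp [Instr.apply, h29₃, e₃.one]
    · rw [List.length_append, List.length_singleton] at hxl
      by_cases hxe : x = l.length
      · subst hxe
        simp [Instr.apply, h29₃, h8]
      · have hx' : x < l.length := by omega
        simpa [Instr.apply, h29₃, hxe, List.getElem_append_left hx', hq₃] using hx x hx'
    · rw [Test.Holds, e₃.one, h₃] at hb
      rw [hmem]
      refine and_congr_right fun hi => ⟨fun hit => by omega, fun hit => ?_⟩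
      rcases Nat.lt_succ_iff_lt_or_eq.1 hit with hit | hit
      · exact hit
      · have : i = ⟨t, ht⟩ := Fin.ext hit
        exact absurd (this ▸ hi) hb
    · rw [State.setN_narr, hq₃]
      exact hx x hxl
  · rintro s₂ - ⟨l, hl, hmem, -, hx⟩
    exact ⟨l, hl, fun i => by simp [hmem], hx⟩

/-- Finds a kernel vector on the listed columns and writes it to the output. -/
def kernelProg : Prog :=
  .seq (block [.nconst 5 0, .nadd 6 0 3]) <| .seq gsProg
    (forLoop 8 1 (block [.nadd 11 0 8, .rload 3 2 4 11, .rstore 1 3 8 3]))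

def kernelCost {R : Type*} [CommSemiring R] (n m : R) : R :=
  2 + (gsCost n m + (2 + m * (3 + 2)))

/-- With more than d inliers among its n columns, U is dependent, so the orthogonalization stops at
some K < n and the coefficients of row K form the kernel vector. -/
theorem within_kernelProg (h : InlierModel A T d) {s : State} (hs : Env A s)
    {U : Finset (Fin m)} (hc : U.card = n) (hd : d < (U ∩ inliers A T).card) {l : List (Fin m)}
    (hl : l.Nodup) (hmem : ∀ i, i ∈ l ↔ i ∈ U)
    (hx : ∀ (x : ℕ) (hx : x < l.length), s.narr 2 x = (l[x] : ℕ)) :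
    Within kernelProg s (kernelCost n m) fun s' => ∃ u, IsKernelVector A U u ∧
      ∀ j : Fin m, s'.rarr 1 0 j = u j := by
  have hlU : l.toFinset = U := by ext; simp [hmem]
  have hlen : l.length = n := by rw [← List.toFinset_card_of_nodup hl, hlU, hc]
  have hlpos : 0 < l.length := hlen ▸ h.pos
  -- The default `l[0]` only makes q total; positions from n on are never used.
  let q : ℕ → Fin m := fun t => if ht : t < l.length then l[t] else l[0]
  have hq : ∀ t (ht : t < l.length), q t = l[t] := fun t ht => dif_pos ht
  have hinj : Set.InjOn q (Set.Iio n) := by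
    intro a ha b hb hab
    have ha' : a < l.length := hlen.symm ▸ ha
    have hb' : b < l.length := hlen.symm ▸ hb
    rw [hq a ha', hq b hb'] at hab
    exact (hl.getElem_inj_iff).1 hab
  have himg : (Finset.range n).image q = U := by
    ext i
    rw [← hmem, List.mem_iff_getElem, Finset.mem_image]
    constructor
    · rintro ⟨t, ht, rfl⟩
      have ht' : t < l.length := hlen.symm ▸ Finset.mem_range.1 ht
      exact ⟨t, ht', (hq t ht').symm⟩
    · rintro ⟨t, ht, rfl⟩
      exact ⟨t, Finset.mem_range.2 (hlen ▸ ht), hq t ht⟩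
  refine .seq (Q := fun s' => s'.nreg 5 = 0 ∧ s'.nreg 6 = n) (.block rfl ?_)
    fun s₁ hf₁ ⟨h5, h6⟩ => ?_
  · simp [Instr.apply, hs.rows, hs.zero]
  have e₁ := hs.of_sameOutside hf₁ (by decide) (by decide)
  refine .seq (within_gsProg e₁ (q := q) h6 h.le ?_ hinj) fun s₂ hf₂ hG => ?_
  · intro t ht
    have ht' : t < l.length := hlen.symm ▸ ht
    rw [h5, zero_add, hf₁.narr 2 (by decide), hx t ht', hq t ht']
  have e₂ := e₁.of_sameOutside hf₂ (by decide) (by decide)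
  have hK := h.lt_of_window hG (by rw [himg]; exact hd)
  have hker := hG.isKernelVector hK (hG.residue_eq_zero hK)
  have hsub : insert (q (s₂.nreg 4)) ((Finset.range (s₂.nreg 4)).image q) ⊆ U := by
    rw [← himg]
    refine Finset.insert_subset (Finset.mem_image_of_mem q (Finset.mem_range.2 hK))
      (Finset.image_subset_image (Finset.range_subset_range.2 hK.le))
  refine .forLoop (fun k s' => ∀ j : Fin m, (j : ℕ) < k →
      s'.rarr 1 0 j = coeff n m (s₂.rarr 2 (s₂.nreg 4)) j)
    e₂.cols e₂.one (by decide) (by decide) (by simp) ?_ ?_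
  · intro t s₃ ht hf₃ hc₃ h₃
    have e₃ := e₂.of_sameOutside hf₃ (by decide) (by decide)
    have h4 := hf₃.nreg 4 (by decide)
    have hB := hf₃.rarr 2 (by decide)
    refine .block rfl fun j hj => ?_
    by_cases hjt : (j : ℕ) = t
    · simp [Instr.apply, e₃.zero, e₃.rows, hc₃, h4, hB, hjt, coeff]
    · simpa [Instr.apply, e₃.zero, hc₃, hjt] using h₃ j (by omega)
  · intro s₃ _ h₃
    exact ⟨_, ⟨hker.1, fun i hi => hker.2.1 i fun hm => hi (hsub hm), hker.2.2⟩,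
      fun j => h₃ j j.2⟩

/-! ### The assembled program and its polynomial step bound. -/

/-- The whole program. -/
def findSubspaceProg : Prog :=
  .seq initProg <| .seq searchProg <| .seq markProg <| .seq countProg <| .seq loopProg <|
    .seq collectProg kernelProg

def findSubspaceCost {R : Type*} [CommSemiring R] (n m : R) : R :=
  initCost m + (searchCost n m + (markCost n m + (countCost n m + (loopCost m +
    (collectCost m + kernelCost n m)))))

theorem within_findSubspaceProg (h : InlierModel A T d) :
    Within findSubspaceProg (inputState A) (findSubspaceCost n m) fun s =>
      ∃ D U u, IsRun A (Equiv.refl (Fin m)) D U u ∧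
        Outputs s D u (inliers A (foundSubspace A u)) := by
  have hm : 0 < m := h.pos.trans_le h.le
  have : NeZero m := ⟨hm.ne'⟩
  refine .seq (within_initProg A) fun s₁ _ ⟨e₁, h4, h6, h0, hlist⟩ => ?_
  -- The list of columns is stored twice in a row, so every rotation is a contiguous segment and no
  -- modular reduction is needed.
  have hrot : ∀ σ < m, ∀ j < m, s₁.narr 2 (σ + j) = rotation m σ j := by
    intro σ hσ j hj
    rw [rotation, Fin.val_ofNat]
    by_cases hlt : σ + j < m
    · rw [Nat.mod_eq_of_lt hlt]
      exact (hlist _ hlt).1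
    · have hsub : σ + j - m < m := by omega
      rw [Nat.mod_eq_sub_mod (by omega), Nat.mod_eq_of_lt hsub]
      have := (hlist _ hsub).2.1
      rwa [Nat.sub_add_cancel (by omega)] at this
  refine .seq (within_searchProg h e₁ h4 h6 hrot) fun s₂ hf₂ hF => ?_
  have e₂ := e₁.of_sameOutside hf₂ (by decide) (by decide)
  refine .seq (within_markProg e₂ (fun x => by rw [hf₂.narr 1 (by decide)]; exact h0 x))
    fun s₃ hf₃ hM => ?_
  have e₃ := e₂.of_sameOutside hf₃ (by decide) (by decide)
  have hM₃ : Marks (s₃.narr 1) (· ∈ inliers A T) := hM.congr fun i =>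
    (h.mem_inliers_iff hF.gs (rotation_injOn _) (rotation_surjective _) hF.lt
      (hF.lt.trans_le h.le) i).symm
  have hF₃ : Found A s₃ := by
    have h4 := hf₃.nreg 4 (by decide)
    have h5 := hf₃.nreg 5 (by decide)
    have hB := hf₃.rarr 2 (by decide)
    exact ⟨h4 ▸ hF.lt, h5 ▸ hF.offset, by rw [h4, h5, hB]; exact hF.gs⟩
  refine .seq (within_countProg h e₃ hF₃ hM₃ fun σ hσ j hj => ?_) fun s₄ hf₄ ⟨hd, hl⟩ => ?_
  · rw [hf₃.narr 2 (by decide), hf₂.narr 2 (by decide), hrot σ hσ j hj]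
  have e₄ := e₃.of_sameOutside hf₄ (by decide) (by decide)
  have hM₄ : Marks (s₄.narr 1) (· ∈ inliers A T) := by rw [hf₄.narr 1 (by decide)]; exact hM₃
  refine .seq (within_loopProg h e₄ hM₄ hd hl fun i hi => ?_) fun s₅ hf₅ ⟨D, U, hc, hD⟩ => ?_
  · rw [hf₄.narr 3 (by decide), hf₃.narr 3 (by decide), hf₂.narr 3 (by decide)]
    exact (hlist i hi).2.2
  have e₅ := e₄.of_sameOutside hf₅ (by decide) (by decide)
  have hrun : LoopRun A (Equiv.refl _) Finset.univ D U := by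
    simpa using hD.run [] U (.done U hc.le)
  refine .seq (within_collectProg e₅ hD.alive) fun s₆ hf₆ ⟨l, hl, hmem, hx⟩ => ?_
  have e₆ := e₅.of_sameOutside hf₆ (by decide) (by decide)
  refine (within_kernelProg h e₆ hc (h.loopRun_univ hrun).2 hl hmem hx).mono le_rfl
    fun s₇ hf₇ ⟨u, hu, hout⟩ => ?_
  have hisRun : IsRun A (Equiv.refl _) D U u := ⟨hrun, hu⟩
  refine ⟨D, U, u, hisRun, fun k hk => ?_, hout, fun j => ?_⟩
  · rw [hf₇.narr 0 (by decide), hf₆.narr 0 (by decide)]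
    exact hD.out k hk
  -- The marks were computed before the loop as the inliers of T; correctness of the run identifies
  -- them with the inliers of the found subspace.
  · rw [hf₇.narr 1 (by decide), hf₆.narr 1 (by decide), hf₅.narr 1 (by decide),
      h.foundSubspace_of_isRun hisRun]
    exact hM₄.eq_ite j

end

/-- The step bound as a polynomial in the numbers of rows and columns. -/
theorem eval_findSubspaceCost (n m : ℕ) :
    MvPolynomial.eval ![n, m] (findSubspaceCost (MvPolynomial.X 0) (MvPolynomial.X 1)) =
      findSubspaceCost n m := by
  simp [findSubspaceCost, initCost, searchCost, markCost, countCost, loopCost, collectCost,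
    kernelCost, gsCost, rowCost, reduceCost, loadCost, dotCost, deleteCost, findCost]

end RobustSubspace

theorem mainTheorem4 :
    ∃ (P : RobustSubspace.Prog) (p : MvPolynomial (Fin 2) ℕ),
      ∀ (n m d : ℕ) (A : Matrix (Fin n) (Fin m) ℝ) (T : Submodule ℝ (Fin n → ℝ)),
        0 < n → n ≤ m → A.rank = n →
        Module.finrank ℝ T = d →
        RobustSubspace.GeneralPosition A T d →
        (d : ℝ) / (n : ℝ) * (m : ℝ) < ((RobustSubspace.inliers A T).card : ℝ) →
        -- every run, for every scan order and every kernel vector, computes `T` and the inliers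
        (∀ π : Equiv.Perm (Fin m),
          (∃ D U u, RobustSubspace.IsRun A π D U u) ∧
          (∀ D U u, RobustSubspace.IsRun A π D U u →
            RobustSubspace.foundSubspace A u = T ∧
            RobustSubspace.inliers A (RobustSubspace.foundSubspace A u) =
              RobustSubspace.inliers A T)) ∧
        -- the program `P` carries out such a run in at most `p(n, m)` steps
        (∃ (k : ℕ) (s : RobustSubspace.State),
          RobustSubspace.Exec P (RobustSubspace.inputState A) k s ∧
          k ≤ MvPolynomial.eval ![n, m] p ∧
          ∃ D U u, RobustSubspace.IsRun A (Equiv.refl (Fin m)) D U u ∧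
            RobustSubspace.Outputs s D u
              (RobustSubspace.inliers A (RobustSubspace.foundSubspace A u))) := by
  refine ⟨RobustSubspace.findSubspaceProg,
    RobustSubspace.findSubspaceCost (MvPolynomial.X 0) (MvPolynomial.X 1), ?_⟩
  intro n m d A T hn hnm hrank hdim hgen hmany
  have h : RobustSubspace.InlierModel A T d := by
    refine ⟨hn, hnm, hrank, hdim, hgen, ?_⟩
    have hnR : (0 : ℝ) < n := by exact_mod_cast hn
    rw [div_mul_eq_mul_div, div_lt_iff₀ hnR, mul_comm _ (n : ℝ)] at hmany
    exact_mod_cast hmany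
  refine ⟨fun π => ⟨h.exists_isRun π, fun D U u hrun => ?_⟩, ?_⟩
  · rw [h.foundSubspace_of_isRun hrun]
    exact ⟨rfl, rfl⟩
  · rw [RobustSubspace.eval_findSubspaceCost]
    exact RobustSubspace.within_findSubspaceProg h
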